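/- All systems are finite dimensional and $\log=\log_2$. For a quantum channel $\Phi$ from $A$ to $B$, that is, a map of the form $\Phi(\rho)=\mathrm{tr}_E(V\rho V^*)$ with an isometry $V:A\to B\otimes E$, let $$C^{(1)}(\Phi)=\max_\rho I(X;B)$$ be its (one-shot) classical information. The maximum is over all classical-quantum states $\rho^{XA}=\sum_x p_x|x\rangle\langle x|\otimes\rho_x^A$ with a classical register $X$ of any finite size, and $I(X;B)=H(X)+H(B)-H(XB)$ is the quantum mutual information of $(\mathrm{id}_X\otimes\Phi)(\rho^{XA})$, with $H$ the von Neumann entropy. For $0\le p\le 1$ and $d\ge 1$ let $\mathcal E_{p,d}(\rho)=(1-p)\rho+p\,\mathrm{tr}(\rho)\,|e\rangle\langle e|$ be the erasure channel from $\mathbb C^d$ to $\mathbb C^d\oplus\mathbb C|e\rangle$. Then for every quantum channel $\mathcal N$ and every integer $n\ge 0$ the maxima defining $C^{(1)}(\mathcal N)$, $C^{(1)}(\mathcal E_{p,d})$ and $C^{(1)}(\mathcal N\otimes\mathcal E_{p,d}^{\otimes n})$ are attained, and $$C^{(1)}\bigl(\mathcal N\otimes\mathcal E_{p,d}^{\otimes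 n}\bigr)=C^{(1)}(\mathcal N)+n\,C^{(1)}(\mathcal E_{p,d}),\qquad C^{(1)}(\mathcal E_{p,d})=(1-p)\log d .$$ -/

import Mathlib

open scoped Matrix Kronecker ComplexOrder

noncomputable section

namespace QInfo

variable {A B C D X : Type*} [Fintype A] [Fintype B] [Fintype C] [Fintype D] [Fintype X]
  [DecidableEq A] [DecidableEq B] [DecidableEq C] [DecidableEq D] [DecidableEq X]

/-- A linear map from the operators on the finite dimensional Hilbert space `ℂ^A` to the operators
on `ℂ^B`, both written as matrices in the computational basis. -/
abbrev SuperOp (A B : Type*) := Matrix A A ℂ →ₗ[ℂ] Matrix B B ℂ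

/-- Density matrices: positive semidefinite of trace one. -/
def IsState (ρ : Matrix A A ℂ) : Prop := ρ.PosSemidef ∧ ρ.trace = 1

/-- Partial trace over the first factor. -/
def traceFst (σ : Matrix (A × B) (A × B) ℂ) : Matrix B B ℂ :=
  Matrix.of fun b b' => ∑ a, σ (a, b) (a, b')

/-- Partial trace over the second factor. -/
def traceSnd (σ : Matrix (A × B) (A × B) ℂ) : Matrix A A ℂ :=
  Matrix.of fun a a' => ∑ b, σ (a, b) (a', b)

/-- Quantum channels: `Φ ρ = tr_E (V ρ V*)` for an isometry `V : ℂ^A → ℂ^B ⊗ ℂ^E` with a finite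
dimensional environment `E` (equivalently, completely positive trace preserving maps). -/
def IsChannel (Φ : SuperOp A B) : Prop :=
  ∃ (r : ℕ) (V : Matrix (B × Fin r) A ℂ), Vᴴ * V = 1 ∧ ∀ ρ, Φ ρ = traceSnd (V * ρ * Vᴴ)

/-- The tensor product `Φ ⊗ Ψ`, by linear extension from the matrix units. -/
def tensor (Φ : SuperOp A B) (Ψ : SuperOp C D) : SuperOp (A × C) (B × D) where
  toFun ρ := ∑ k, ∑ l, ρ k l • (Φ (Matrix.single k.1 l.1 1) ⊗ₖ Ψ (Matrix.single k.2 l.2 1))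
  map_add' ρ σ := by simp only [Matrix.add_apply, add_smul, Finset.sum_add_distrib]
  map_smul' c ρ := by
    simp only [Matrix.smul_apply, smul_eq_mul, mul_smul, Finset.smul_sum, RingHom.id_apply]

/-- The tensor power `Φ^{⊗ n}`, by linear extension from the matrix units; the computational basis
of the `n`-fold tensor power of `ℂ^A` is indexed by `Fin n → A`. -/
def tensorPow (Φ : SuperOp A B) (n : ℕ) : SuperOp (Fin n → A) (Fin n → B) where
  toFun ρ := ∑ k, ∑ l, ρ k l •
    Matrix.of fun i j : Fin n → B => ∏ t, Φ (Matrix.single (k t) (l t) 1) (i t) (j t)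
  map_add' ρ σ := by simp only [Matrix.add_apply, add_smul, Finset.sum_add_distrib]
  map_smul' c ρ := by
    simp only [Matrix.smul_apply, smul_eq_mul, mul_smul, Finset.smul_sum, RingHom.id_apply]

/-- The von Neumann entropy `-Tr (ρ log₂ ρ)` in bits, through the functional calculus of the
Hermitian matrix `ρ` (with `0 log 0 = 0`). -/
def entropy (ρ : Matrix A A ℂ) : ℝ := (cfc Real.negMulLog ρ).trace.re / Real.log 2

/-- The quantum mutual information `I(X;B) = H(X) + H(B) - H(XB)` of a bipartite state. -/
def mutualInfo (σ : Matrix (X × B) (X × B) ℂ) : ℝ :=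
  entropy (traceSnd σ) + entropy (traceFst σ) - entropy σ

/-- The classical-quantum states `∑ x, p_x |x⟩⟨x| ⊗ ρ_x` on the registers `X` and `A`. -/
def cqStates (X A : Type*) [Fintype X] [Fintype A] [DecidableEq X] :
    Set (Matrix (X × A) (X × A) ℂ) :=
  {σ | ∃ (p : X → ℝ) (ρ : X → Matrix A A ℂ), (∀ x, 0 ≤ p x) ∧ ∑ x, p x = 1 ∧
    (∀ x, IsState (ρ x)) ∧ σ = ∑ x, (p x : ℂ) • (Matrix.single x x (1 : ℂ) ⊗ₖ ρ x)}

/-- All values `I(X;B)` obtained by sending the register `A` of a classical-quantum state, with a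
classical register `X` of any finite size, through `Φ`. -/
def infoValues (Φ : SuperOp A B) : Set ℝ :=
  {v | ∃ m : ℕ, ∃ σ ∈ cqStates (Fin m) A,
    v = mutualInfo (tensor (LinearMap.id : SuperOp (Fin m) (Fin m)) Φ σ)}

/-- The (one-shot) classical information of `Φ`. -/
def classicalInfo (Φ : SuperOp A B) : ℝ := sSup (infoValues Φ)

/-- The isometric inclusion of `ℂ^A` into `ℂ^A ⊕ ℂ|e⟩`; the erasure flag `e` is `none`. -/
def flagInclusion (A : Type*) [DecidableEq A] : Matrix (Option A) A ℂ :=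
  Matrix.of fun o a => if o = some a then 1 else 0

/-- The erasure channel `ρ ↦ (1 - p) ρ + p tr(ρ) |e⟩⟨e|` with `d` dimensional input. -/
def erasure (p : ℝ) (d : ℕ) : SuperOp (Fin d) (Option (Fin d)) where
  toFun ρ := ((1 - p : ℝ) : ℂ) • (flagInclusion (Fin d) * ρ * (flagInclusion (Fin d))ᴴ) +
    ((p : ℂ) * ρ.trace) • Matrix.single none none 1
  map_add' ρ σ := by
    simp only [Matrix.mul_add, Matrix.add_mul, Matrix.trace_add, mul_add, add_smul, smul_add]
    abel
  map_smul' c ρ := by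
    simp only [Matrix.mul_smul, Matrix.smul_mul, Matrix.trace_smul, smul_add, smul_smul,
      smul_eq_mul, RingHom.id_apply]
    congr 2 <;> ring

end QInfo

end

/-!
The mutual information of the output of a channel `Φ` on a classical-quantum state is the Holevo
quantity `H(Φ(∑ p_x ρ_x)) - ∑ p_x H(Φ(ρ_x))` (`mutualInfo_tensor_id`).

*Attainment.* The Holevo quantity is a function of the barycentre of the points `(ρ_x, H(Φ(ρ_x)))`,
so by Carathéodory's theorem a fixed number of signals suffices (`IsEnsemble.exists_signalBound`).
Ensembles of that size form a compact set, and the entropy is continuous.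

*Additivity.* The output of `Φ ⊗ ℰ` is the orthogonal sum of the output of `Φ ⊗ id` with weight
`1 - p` and of that of `Φ` with weight `p`, and so the Holevo quantities average with the same
weights (`holevo_tensor_erasure`). It remains to see that a noiseless system `D` adds at most
`log d` (`holevo_tensor_id_le`). For the entropy of the mean output, subadditivity gives
`H(BD) ≤ H(B) + log d` (`entropy_le_entropy_traceSnd_add`). For each signal, concavity of the
entropy allows one to assume that the input of `Φ ⊗ id` is pure. Then `H(BD) = H(E)`, where `E` is
the environment of `Φ`. Measuring `D` in a basis turns the signal into an ensemble of pure inputs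
`φ_k` of `Φ` and the state of `E` into the corresponding mixture, so that by concavity again
`H(BD) = H(E) ≥ ∑ q_k H(E)_{φ_k} = ∑ q_k H(Φ(φ_k))` (`exists_ensemble_of_proj`). The signals `φ_k`
together form an ensemble for `Φ`, whose Holevo quantity bounds what is left. Product signals
`ρ_x ⊗ |j⟩⟨j|` attain the bound. The tensor power follows by induction on `n` from
`N ⊗ ℰ^{⊗(n+1)} ≅ (N ⊗ ℰ) ⊗ ℰ^{⊗n}`, and the value for `ℰ` alone from `ℰ ≅ id_ℂ ⊗ ℰ`.
-/

noncomputable section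

namespace QInfo

set_option linter.unusedSectionVars false

open Real (negMulLog)

/-! ### Spectral formulas for the entropy -/

section Spectral

variable {A B D : Type*} [Fintype A] [Fintype B] [Fintype D] [DecidableEq A] [DecidableEq B]
  [DecidableEq D]

lemma entropy_eq_sum_eigenvalues {ρ : Matrix A A ℂ} (hρ : ρ.IsHermitian) :
    entropy ρ = (∑ i, negMulLog (hρ.eigenvalues i)) / Real.log 2 := by
  unfold entropy
  rw [hρ.cfc_eq, Matrix.IsHermitian.cfc, Unitary.conjStarAlgAut_apply, Matrix.trace_mul_comm,
    ← mul_assoc]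
  simp [Matrix.trace]

lemma entropy_eq_sum_roots {ρ : Matrix A A ℂ} (hρ : ρ.IsHermitian) :
    entropy ρ = (ρ.charpoly.roots.map fun z => negMulLog z.re).sum / Real.log 2 := by
  rw [entropy_eq_sum_eigenvalues hρ, hρ.roots_charpoly_eq_eigenvalues]
  simp

open Polynomial in
/-- The entropy depends only on the nonzero part of the spectrum, since `0 log 0 = 0`. -/
lemma entropy_mul_comm (M : Matrix A B ℂ) (N : Matrix B A ℂ) (h : (M * N).IsHermitian)
    (h' : (N * M).IsHermitian) : entropy (M * N) = entropy (N * M) := by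
  have key := Matrix.charpoly_mul_comm' M N
  -- Extra roots at zero do not contribute.
  have h1 : ∀ (n : ℕ) (q : ℂ[X]), q.Monic →
      ((X ^ n * q).roots.map fun z : ℂ => negMulLog z.re).sum =
        (q.roots.map fun z : ℂ => negMulLog z.re).sum := by
    intro n q hq
    rw [roots_mul (mul_ne_zero (pow_ne_zero _ X_ne_zero) hq.ne_zero), roots_X_pow,
      Multiset.map_add, Multiset.map_nsmul]
    simp [Multiset.sum_nsmul]
  rw [entropy_eq_sum_roots h, entropy_eq_sum_roots h',
    ← h1 _ _ (Matrix.charpoly_monic (M * N)), key, h1 _ _ (Matrix.charpoly_monic (N * M))]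

lemma entropy_mul_conjTranspose_self (M : Matrix A B ℂ) :
    entropy (M * Mᴴ) = entropy (Mᴴ * M) :=
  entropy_mul_comm _ _ (Matrix.isHermitian_mul_conjTranspose_self M)
    (Matrix.isHermitian_conjTranspose_mul_self M)

lemma entropy_unitary_conj (U : Matrix.unitaryGroup A ℂ) {ρ : Matrix A A ℂ}
    (hρ : ρ.IsHermitian) : entropy ((U : Matrix A A ℂ)ᴴ * ρ * (U : Matrix A A ℂ)) = entropy ρ := by
  have hU : (U : Matrix A A ℂ) * (U : Matrix A A ℂ)ᴴ = 1 := Unitary.coe_mul_star_self U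
  have e : (U : Matrix A A ℂ) * ((U : Matrix A A ℂ)ᴴ * ρ) = ρ := by
    rw [← Matrix.mul_assoc, hU, Matrix.one_mul]
  have := entropy_mul_comm ((U : Matrix A A ℂ)ᴴ * ρ) U
    (Matrix.isHermitian_conjTranspose_mul_mul _ hρ) (by rw [e]; exact hρ)
  rw [this, e]

lemma entropy_reindex (e : A ≃ B) {ρ : Matrix A A ℂ} (hρ : ρ.IsHermitian) :
    entropy (ρ.submatrix e.symm e.symm) = entropy ρ := by
  rw [entropy_eq_sum_roots hρ, entropy_eq_sum_roots (hρ.submatrix _)]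
  have := Matrix.charpoly_reindex e ρ
  rw [Matrix.reindex_apply] at this
  rw [this]

lemma entropy_fromBlocks {ρ : Matrix A A ℂ} {σ : Matrix B B ℂ} (hρ : ρ.IsHermitian)
    (hσ : σ.IsHermitian) :
    entropy (Matrix.fromBlocks ρ 0 0 σ) = entropy ρ + entropy σ := by
  have h : (Matrix.fromBlocks ρ 0 0 σ).IsHermitian := hρ.fromBlocks (by simp) hσ
  rw [entropy_eq_sum_roots hρ, entropy_eq_sum_roots hσ, entropy_eq_sum_roots h,
    Matrix.charpoly_fromBlocks_zero₁₂, Polynomial.roots_mul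
      (mul_ne_zero (Matrix.charpoly_monic _).ne_zero (Matrix.charpoly_monic _).ne_zero),
    Multiset.map_add, Multiset.sum_add, add_div]

lemma charpoly_blockDiagonal (σ : D → Matrix A A ℂ) :
    (Matrix.blockDiagonal σ).charpoly = ∏ k, (σ k).charpoly := by
  have : (Matrix.blockDiagonal σ).charmatrix = Matrix.blockDiagonal fun k => (σ k).charmatrix := by
    ext ⟨i, k⟩ ⟨j, l⟩
    by_cases hkl : k = l <;> by_cases hij : i = j <;>
      simp [Matrix.blockDiagonal_apply, hkl, hij]
  rw [Matrix.charpoly, this, Matrix.det_blockDiagonal]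
  rfl

lemma entropy_blockDiagonal {σ : D → Matrix A A ℂ} (hσ : ∀ k, (σ k).IsHermitian) :
    entropy (Matrix.blockDiagonal σ) = ∑ k, entropy (σ k) := by
  have h : (Matrix.blockDiagonal σ).IsHermitian := by
    rw [Matrix.IsHermitian, Matrix.blockDiagonal_conjTranspose]
    congr 1; ext1 k; exact hσ k
  rw [entropy_eq_sum_roots h, charpoly_blockDiagonal, Polynomial.roots_prod _ _
    (Finset.prod_ne_zero_iff.2 fun k _ => (Matrix.charpoly_monic _).ne_zero)]
  simp_rw [fun k => entropy_eq_sum_roots (hσ k)]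
  rw [Multiset.map_bind, Multiset.sum_bind, ← Finset.sum_div]
  rfl

lemma entropy_diagonal (w : A → ℝ) :
    entropy (Matrix.diagonal fun i => (w i : ℂ)) = (∑ i, negMulLog (w i)) / Real.log 2 := by
  have h : (∏ i, (Polynomial.X - Polynomial.C (w i : ℂ))).roots =
      Finset.univ.val.map fun i => (w i : ℂ) := by
    rw [Polynomial.roots_prod _ _
      (Finset.prod_ne_zero_iff.2 fun i _ => Polynomial.X_sub_C_ne_zero _)]
    simp [Multiset.bind_singleton]
  rw [entropy_eq_sum_roots (Matrix.isHermitian_diagonal_of_self_adjoint _ (by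
    ext i; simp)), Matrix.charpoly_diagonal, h]
  simp

/-- Diagonalization by the matrix of eigenvectors. -/
lemma conj_eigenvectorUnitary {ρ : Matrix A A ℂ} (hρ : ρ.IsHermitian) :
    (hρ.eigenvectorUnitary : Matrix A A ℂ)ᴴ * ρ * (hρ.eigenvectorUnitary : Matrix A A ℂ) =
      Matrix.diagonal fun i => (hρ.eigenvalues i : ℂ) := by
  have := hρ.conjStarAlgAut_star_eigenvectorUnitary
  rw [Unitary.conjStarAlgAut_apply] at this
  simpa [Matrix.star_eq_conjTranspose, Function.comp_def] using this

lemma eq_eigenvectorUnitary_conj {ρ : Matrix A A ℂ} (hρ : ρ.IsHermitian) :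
    ρ = (hρ.eigenvectorUnitary : Matrix A A ℂ) *
      Matrix.diagonal (fun i => (hρ.eigenvalues i : ℂ)) *
        (hρ.eigenvectorUnitary : Matrix A A ℂ)ᴴ := by
  have := hρ.spectral_theorem
  rw [Unitary.conjStarAlgAut_apply] at this
  exact this

lemma isHermitian_ofReal_smul {A : Type*} {ρ : Matrix A A ℂ} (hρ : ρ.IsHermitian) (c : ℝ) :
    ((c : ℂ) • ρ).IsHermitian := by
  simp [Matrix.IsHermitian, Matrix.conjTranspose_smul, hρ.eq]

lemma entropy_smul {ρ : Matrix A A ℂ} (hρ : ρ.IsHermitian) (c : ℝ) :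
    entropy ((c : ℂ) • ρ) = c * entropy ρ + negMulLog c * ρ.trace.re / Real.log 2 := by
  have hc := isHermitian_ofReal_smul hρ c
  rw [← entropy_unitary_conj hρ.eigenvectorUnitary hc, Matrix.mul_smul, Matrix.smul_mul,
    conj_eigenvectorUnitary]
  have : (c : ℂ) • Matrix.diagonal (fun i => (hρ.eigenvalues i : ℂ)) =
      Matrix.diagonal fun i => ((c * hρ.eigenvalues i : ℝ) : ℂ) := by
    ext i j; by_cases h : i = j <;> simp [h]
  rw [this, entropy_diagonal, entropy_eq_sum_eigenvalues hρ, hρ.trace_eq_sum_eigenvalues]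
  simp only [Real.negMulLog_mul, Finset.sum_add_distrib, ← Finset.mul_sum, ← Finset.sum_mul]
  simp
  ring

end Spectral

/-! ### Concavity and subadditivity -/

section Inequalities

variable {A D ι : Type*} [Fintype A] [Fintype D] [DecidableEq A] [DecidableEq D] [Fintype ι]

lemma log_two_nonneg : 0 ≤ Real.log 2 := (Real.log_pos one_lt_two).le

/-- Dephasing in an orthonormal basis, here the columns of a unitary `U`, does not decrease the
entropy: the new diagonal is a doubly stochastic mixture of the eigenvalues. -/
lemma entropy_le_sum_diag {ρ : Matrix A A ℂ} (hρ : ρ.PosSemidef) (U : Matrix.unitaryGroup A ℂ) :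
    entropy ρ ≤ (∑ j, negMulLog
      (((U : Matrix A A ℂ)ᴴ * ρ * (U : Matrix A A ℂ)) j j).re) / Real.log 2 := by
  have hH := hρ.isHermitian
  set V : Matrix.unitaryGroup A ℂ := star U * hH.eigenvectorUnitary with hV
  have hdiag : ∀ j, (((U : Matrix A A ℂ)ᴴ * ρ * (U : Matrix A A ℂ)) j j).re =
      ∑ i, ‖(V : Matrix A A ℂ) j i‖ ^ 2 * hH.eigenvalues i := by
    intro j
    have : (U : Matrix A A ℂ)ᴴ * ρ * (U : Matrix A A ℂ) = (V : Matrix A A ℂ) *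
        Matrix.diagonal (fun i => (hH.eigenvalues i : ℂ)) * (V : Matrix A A ℂ)ᴴ := by
      conv_lhs => rw [eq_eigenvectorUnitary_conj hH]
      simp [hV, Matrix.mul_assoc, Matrix.star_eq_conjTranspose]
    rw [this, Matrix.mul_apply, Complex.re_sum]
    refine Finset.sum_congr rfl fun i _ => ?_
    rw [Matrix.mul_diagonal, Matrix.conjTranspose_apply, mul_right_comm, Complex.star_def,
      Complex.mul_conj, Complex.normSq_eq_norm_sq, ← Complex.ofReal_mul, Complex.ofReal_re]
  have hrow : ∀ j, ∑ i, ‖(V : Matrix A A ℂ) j i‖ ^ 2 = 1 := by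
    intro j
    have : ((V : Matrix A A ℂ) * star (V : Matrix A A ℂ)) j j = (1 : Matrix A A ℂ) j j :=
      congrFun (congrFun (Unitary.coe_mul_star_self V) j) j
    simp only [Matrix.star_eq_conjTranspose, Matrix.mul_apply, Matrix.conjTranspose_apply,
      Complex.star_def, Complex.mul_conj, Complex.normSq_eq_norm_sq, Matrix.one_apply_eq] at this
    exact_mod_cast this
  have hcol : ∀ i, ∑ j, ‖(V : Matrix A A ℂ) j i‖ ^ 2 = 1 := by
    intro i
    have : (star (V : Matrix A A ℂ) * (V : Matrix A A ℂ)) i i = (1 : Matrix A A ℂ) i i :=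
      congrFun (congrFun (Unitary.coe_star_mul_self V) i) i
    simp only [Matrix.star_eq_conjTranspose, Matrix.mul_apply, Matrix.conjTranspose_apply,
      Complex.star_def, Complex.conj_mul', Matrix.one_apply_eq] at this
    exact_mod_cast this
  rw [entropy_eq_sum_eigenvalues hH]
  refine div_le_div_of_nonneg_right ?_ log_two_nonneg
  calc ∑ i, negMulLog (hH.eigenvalues i)
      = ∑ i, ∑ j, ‖(V : Matrix A A ℂ) j i‖ ^ 2 * negMulLog (hH.eigenvalues i) := by
        simp only [← Finset.sum_mul, hcol, one_mul]
    _ = ∑ j, ∑ i, ‖(V : Matrix A A ℂ) j i‖ ^ 2 * negMulLog (hH.eigenvalues i) :=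
        Finset.sum_comm
    _ ≤ _ := by
        refine Finset.sum_le_sum fun j _ => ?_
        rw [hdiag]
        have := Real.concaveOn_negMulLog.le_map_sum (t := Finset.univ)
          (w := fun i => ‖(V : Matrix A A ℂ) j i‖ ^ 2) (p := hH.eigenvalues)
          (fun i _ => by positivity) (hrow j) (fun i _ => hρ.eigenvalues_nonneg i)
        simpa only [smul_eq_mul] using this

lemma posSemidef_sum_smul {A ι : Type*} [Fintype ι] {q : ι → ℝ} (hq : ∀ y, 0 ≤ q y)
    {σ : ι → Matrix A A ℂ} (hσ : ∀ y, (σ y).PosSemidef) : (∑ y, (q y : ℂ) • σ y).PosSemidef :=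
  Matrix.posSemidef_sum _ fun y _ => (hσ y).smul (by exact_mod_cast hq y)

/-- Concavity of the entropy, by dephasing every term in an eigenbasis of the mixture. -/
lemma entropy_concave {q : ι → ℝ} (hq : ∀ y, 0 ≤ q y) (hq1 : ∑ y, q y = 1)
    {σ : ι → Matrix A A ℂ} (hσ : ∀ y, (σ y).PosSemidef) :
    ∑ y, q y * entropy (σ y) ≤ entropy (∑ y, (q y : ℂ) • σ y) := by
  have hH := (posSemidef_sum_smul hq hσ).isHermitian
  set U := hH.eigenvectorUnitary with hU
  have hdiag : ∀ j, hH.eigenvalues j =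
      ∑ y, q y * (((U : Matrix A A ℂ)ᴴ * σ y * (U : Matrix A A ℂ)) j j).re := by
    intro j
    have := congrArg (fun M : Matrix A A ℂ => (M j j).re) (conj_eigenvectorUnitary hH)
    simp only [Matrix.diagonal_apply_eq, Complex.ofReal_re] at this
    rw [← this, Finset.mul_sum, Finset.sum_mul, Matrix.sum_apply, Complex.re_sum]
    simp [hU]
  rw [entropy_eq_sum_eigenvalues hH]
  calc ∑ y, q y * entropy (σ y)
      ≤ ∑ y, q y * ((∑ j, negMulLog
          (((U : Matrix A A ℂ)ᴴ * σ y * (U : Matrix A A ℂ)) j j).re) / Real.log 2) :=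
        Finset.sum_le_sum fun y _ =>
          mul_le_mul_of_nonneg_left (entropy_le_sum_diag (hσ y) U) (hq y)
    _ = (∑ j, ∑ y, q y * negMulLog
          (((U : Matrix A A ℂ)ᴴ * σ y * (U : Matrix A A ℂ)) j j).re) / Real.log 2 := by
        rw [Finset.sum_comm, Finset.sum_div]
        simp only [← Finset.mul_sum, mul_div_assoc]
    _ ≤ _ := by
        refine div_le_div_of_nonneg_right (Finset.sum_le_sum fun j _ => ?_) log_two_nonneg
        rw [hdiag]
        have := Real.concaveOn_negMulLog.le_map_sum (t := Finset.univ) (w := q)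
          (p := fun y => (((U : Matrix A A ℂ)ᴴ * σ y * (U : Matrix A A ℂ)) j j).re)
          (fun y _ => hq y) hq1 (fun y _ => by
            have := ((hσ y).conjTranspose_mul_mul_same (U : Matrix A A ℂ)).diag_nonneg (i := j)
            exact (Complex.nonneg_iff.1 this).1)
        simpa only [smul_eq_mul] using this

lemma traceSnd_posSemidef {A D : Type*} [Fintype D] {σ : Matrix (A × D) (A × D) ℂ}
    (hσ : σ.PosSemidef) : (traceSnd σ).PosSemidef := by
  have : traceSnd σ = ∑ k, σ.submatrix (fun a => (a, k)) (fun a => (a, k)) := by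
    ext a a'; simp [traceSnd, Matrix.sum_apply]
  rw [this]
  exact Matrix.posSemidef_sum _ fun k _ => hσ.submatrix _

lemma trace_traceSnd {A D : Type*} [Fintype A] [Fintype D]
    (σ : Matrix (A × D) (A × D) ℂ) : (traceSnd σ).trace = σ.trace := by
  simp [traceSnd, Matrix.trace, Fintype.sum_prod_type]

lemma traceSnd_kronecker_one_conj {A D : Type*} [Fintype A] [Fintype D] [DecidableEq D]
    (W : Matrix A A ℂ) (σ : Matrix (A × D) (A × D) ℂ) :
    traceSnd ((W ⊗ₖ (1 : Matrix D D ℂ))ᴴ * σ * (W ⊗ₖ (1 : Matrix D D ℂ))) =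
      Wᴴ * traceSnd σ * W := by
  ext a a'
  simp only [traceSnd, Matrix.of_apply, Matrix.mul_apply, Matrix.conjTranspose_apply,
    Matrix.kroneckerMap_apply, Matrix.one_apply, Fintype.sum_prod_type, mul_ite, mul_one, mul_zero,
    apply_ite star, star_zero, ite_mul, zero_mul, Finset.sum_ite_eq', Finset.mem_univ, if_true,
    Finset.mul_sum, Finset.sum_mul]
  rw [Finset.sum_comm]
  exact Finset.sum_congr rfl fun _ _ => Finset.sum_comm

/-- `H(BD) ≤ H(B) + log |D|`, by dephasing in an eigenbasis of the marginal on `B`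
and any basis of `D`. -/
lemma entropy_le_entropy_traceSnd_add [Nonempty D] {σ : Matrix (A × D) (A × D) ℂ}
    (hσ : IsState σ) : entropy σ ≤ entropy (traceSnd σ) + Real.logb 2 (Fintype.card D) := by
  obtain ⟨hσ, htr⟩ := hσ
  have hH := (traceSnd_posSemidef hσ).isHermitian
  set W : Matrix A A ℂ := (hH.eigenvectorUnitary : Matrix A A ℂ) with hW
  have hWU : W ⊗ₖ (1 : Matrix D D ℂ) ∈ Matrix.unitaryGroup (A × D) ℂ :=
    Matrix.kronecker_mem_unitary hH.eigenvectorUnitary.2 (one_mem _)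
  set P : A → D → ℝ := fun a k =>
    (((W ⊗ₖ (1 : Matrix D D ℂ))ᴴ * σ * (W ⊗ₖ (1 : Matrix D D ℂ))) (a, k) (a, k)).re with hP
  have hP0 : ∀ a k, 0 ≤ P a k := fun a k =>
    (Complex.nonneg_iff.1 (hσ.conjTranspose_mul_mul_same _).diag_nonneg).1
  have hmarg : ∀ a, ∑ k, P a k = hH.eigenvalues a := by
    intro a
    have h1 := congrArg (fun M : Matrix A A ℂ => (M a a).re) (conj_eigenvectorUnitary hH)
    rw [← hW, ← traceSnd_kronecker_one_conj] at h1
    simpa [traceSnd] using h1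
  have hsum : ∑ a, hH.eigenvalues a = 1 := by
    have : (traceSnd σ).trace = ∑ a, (hH.eigenvalues a : ℂ) := hH.trace_eq_sum_eigenvalues
    rw [trace_traceSnd, htr] at this
    exact_mod_cast this.symm
  set N : ℝ := (Fintype.card D : ℝ) with hN
  have hN0 : 0 < N := by simpa [hN] using Fintype.card_pos
  have hcl : ∀ a, ∑ k, negMulLog (P a k) ≤
      negMulLog (hH.eigenvalues a) + hH.eigenvalues a * Real.log N := by
    intro a
    have := Real.concaveOn_negMulLog.le_map_sum (t := Finset.univ) (w := fun _ : D => N⁻¹)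
      (p := P a) (fun _ _ => by positivity) (by simp [← hN, hN0.ne']) (fun k _ => hP0 a k)
    simp only [smul_eq_mul, ← Finset.mul_sum, hmarg] at this
    rw [Real.negMulLog_mul] at this
    have h2 := mul_le_mul_of_nonneg_left this hN0.le
    rw [← mul_assoc, mul_inv_cancel₀ hN0.ne', one_mul] at h2
    refine h2.trans (le_of_eq ?_)
    simp only [Real.negMulLog, Real.log_inv]
    field_simp
    ring
  refine (entropy_le_sum_diag hσ ⟨_, hWU⟩).trans ?_
  rw [entropy_eq_sum_eigenvalues hH, Real.logb, ← add_div, Fintype.sum_prod_type]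
  refine div_le_div_of_nonneg_right ((Finset.sum_le_sum fun a _ => hcl a).trans (le_of_eq ?_))
    log_two_nonneg
  rw [Finset.sum_add_distrib, ← Finset.sum_mul, hsum, one_mul]

end Inequalities

/-! ### Continuity -/

open scoped Matrix.Norms.L2Operator in
lemma continuousOn_entropy {A : Type*} [Fintype A] [DecidableEq A] :
    ContinuousOn (entropy : Matrix A A ℂ → ℝ) {ρ | ρ.IsHermitian} := by
  have h : ContinuousOn (fun ρ : Matrix A A ℂ => cfc negMulLog ρ) {ρ | ρ.IsHermitian} :=
    ContinuousOn.cfc_of_mem_nhdsSet (s := Set.univ) negMulLog Filter.univ_mem continuousOn_id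
      (fun _ h => h) Real.continuous_negMulLog.continuousOn
  have h2 : Continuous fun M : Matrix A A ℂ => M.trace.re / Real.log 2 := by
    have : Continuous fun M : Matrix A A ℂ => M.trace := continuous_id.matrix_trace
    fun_prop
  exact h2.comp_continuousOn h

/-! ### Channels in Kraus form and their tensor products -/

section Channels

variable {A B C D ι : Type*} [Fintype A] [Fintype B] [Fintype C] [Fintype D] [Fintype ι]
  [DecidableEq A] [DecidableEq B] [DecidableEq C] [DecidableEq D]

/-- `K` is a finite family of Kraus operators of `Φ`, normalized so that `Φ` preserves the trace:
the blocks `⟨e|V` of a Stinespring isometry `V`, with any finite index type for the environment. -/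
def IsKraus (Φ : SuperOp A B) (K : ι → Matrix B A ℂ) : Prop :=
  ∑ e, (K e)ᴴ * K e = 1 ∧ ∀ ρ, Φ ρ = ∑ e, K e * ρ * (K e)ᴴ

lemma IsChannel.exists_isKraus {Φ : SuperOp A B} (h : IsChannel Φ) :
    ∃ (r : ℕ) (K : Fin r → Matrix B A ℂ), IsKraus Φ K := by
  obtain ⟨r, V, hV, hΦ⟩ := h
  refine ⟨r, fun e => V.submatrix (fun b => (b, e)) id, ?_, fun ρ => ?_⟩
  · rw [← hV]
    ext a a'
    simp [Matrix.sum_apply, Matrix.mul_apply, Fintype.sum_prod_type_right]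
  · rw [hΦ]
    ext b b'
    simp [Matrix.sum_apply, Matrix.mul_apply, traceSnd]

lemma IsKraus.isChannel {Φ : SuperOp A B} {K : ι → Matrix B A ℂ} (h : IsKraus Φ K) :
    IsChannel Φ := by
  obtain ⟨hK, hΦ⟩ := h
  let f := Fintype.equivFin ι
  refine ⟨Fintype.card ι, Matrix.of fun x a => K (f.symm x.2) x.1 a, ?_, fun ρ => ?_⟩
  · rw [← hK, ← f.symm.sum_comp]
    ext a a'
    simp [Matrix.sum_apply, Matrix.mul_apply, Fintype.sum_prod_type_right]
  · rw [hΦ, ← f.symm.sum_comp]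
    ext b b'
    simp [Matrix.sum_apply, Matrix.mul_apply, traceSnd]

lemma IsChannel.posSemidef {Φ : SuperOp A B} (h : IsChannel Φ) {ρ : Matrix A A ℂ}
    (hρ : ρ.PosSemidef) : (Φ ρ).PosSemidef := by
  obtain ⟨r, K, -, hK⟩ := h.exists_isKraus
  rw [hK]
  exact Matrix.posSemidef_sum _ fun e _ => hρ.mul_mul_conjTranspose_same _

lemma IsChannel.trace {Φ : SuperOp A B} (h : IsChannel Φ) (ρ : Matrix A A ℂ) :
    (Φ ρ).trace = ρ.trace := by
  obtain ⟨r, K, h1, hK⟩ := h.exists_isKraus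
  rw [hK, Matrix.trace_sum]
  simp_rw [fun e => Matrix.trace_mul_comm (K e * ρ) (K e)ᴴ, ← Matrix.mul_assoc]
  rw [← Matrix.trace_sum, ← Finset.sum_mul, h1, Matrix.one_mul]

lemma IsChannel.isState {Φ : SuperOp A B} (h : IsChannel Φ) {ρ : Matrix A A ℂ}
    (hρ : IsState ρ) : IsState (Φ ρ) :=
  ⟨h.posSemidef hρ.1, (h.trace ρ).trans hρ.2⟩

/-- Linear extension from product operators. -/
lemma kronecker_induction {P : Matrix (A × C) (A × C) ℂ → Prop} (h0 : P 0)
    (hadd : ∀ ρ σ, P ρ → P σ → P (ρ + σ)) (h : ∀ ρ σ, P (ρ ⊗ₖ σ)) (ρ) : P ρ := by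
  rw [Matrix.matrix_eq_sum_single ρ]
  refine Finset.sum_induction _ P hadd h0 fun k _ => Finset.sum_induction _ P hadd h0 fun l _ => ?_
  have : Matrix.single k l (ρ k l) =
      Matrix.single k.1 l.1 (ρ k l) ⊗ₖ Matrix.single k.2 l.2 (1 : ℂ) := by
    rw [Matrix.single_kronecker_single, mul_one]
  rw [this]
  exact h _ _

lemma tensor_single (Φ : SuperOp A B) (Ψ : SuperOp C D) (k l : A × C) :
    tensor Φ Ψ (Matrix.single k l 1) =
      Φ (Matrix.single k.1 l.1 1) ⊗ₖ Ψ (Matrix.single k.2 l.2 1) := by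
  change ∑ k', ∑ l', Matrix.single k l (1 : ℂ) k' l' • _ = _
  rw [Finset.sum_eq_single k (fun k' _ h => Finset.sum_eq_zero fun l' _ => by
    rw [Matrix.single_apply_of_row_ne h.symm, zero_smul]) (by simp),
    Finset.sum_eq_single l (fun l' _ h => by
      rw [Matrix.single_apply_of_col_ne _ _ h.symm, zero_smul]) (by simp)]
  simp

lemma map_eq_sum_single (Φ : SuperOp A B) (ρ : Matrix A A ℂ) :
    Φ ρ = ∑ k, ∑ l, ρ k l • Φ (Matrix.single k l 1) := by
  conv_lhs => rw [Matrix.matrix_eq_sum_single ρ]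
  simp only [map_sum, ← map_smul, Matrix.smul_single, smul_eq_mul, mul_one]

lemma tensor_kronecker (Φ : SuperOp A B) (Ψ : SuperOp C D) (ρ : Matrix A A ℂ)
    (σ : Matrix C C ℂ) : tensor Φ Ψ (ρ ⊗ₖ σ) = Φ ρ ⊗ₖ Ψ σ := by
  ext ⟨b, d⟩ ⟨b', d'⟩
  rw [map_eq_sum_single (tensor Φ Ψ), map_eq_sum_single Φ, map_eq_sum_single Ψ]
  simp only [tensor_single, Matrix.sum_apply, Matrix.smul_apply, Matrix.kroneckerMap_apply,
    smul_eq_mul, Fintype.sum_prod_type, Finset.sum_mul_sum]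
  refine Finset.sum_congr rfl fun a _ => ?_
  refine Finset.sum_congr rfl fun c _ => ?_
  refine Finset.sum_congr rfl fun a' _ => ?_
  refine Finset.sum_congr rfl fun c' _ => ?_
  ring

lemma IsKraus.tensor {κ : Type*} [Fintype κ] {Φ : SuperOp A B} {Ψ : SuperOp C D}
    {K : ι → Matrix B A ℂ} {L : κ → Matrix D C ℂ} (hΦ : IsKraus Φ K) (hΨ : IsKraus Ψ L) :
    IsKraus (tensor Φ Ψ) fun e : ι × κ => K e.1 ⊗ₖ L e.2 := by
  refine ⟨?_, fun ρ => kronecker_induction (P := fun ρ => QInfo.tensor Φ Ψ ρ =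
    ∑ e : ι × κ, (K e.1 ⊗ₖ L e.2) * ρ * (K e.1 ⊗ₖ L e.2)ᴴ) (by simp)
    (fun ρ σ h h' => ?_) (fun ρ σ => ?_) ρ⟩
  · simp only [Matrix.conjTranspose_kronecker, ← Matrix.mul_kronecker_mul]
    rw [← Matrix.one_kronecker_one, ← hΦ.1, ← hΨ.1]
    ext ⟨a, c⟩ ⟨a', c'⟩
    simp only [Matrix.sum_apply, Matrix.kroneckerMap_apply, Fintype.sum_prod_type,
      Finset.sum_mul_sum]
  · rw [map_add, h, h', ← Finset.sum_add_distrib]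
    simp only [Matrix.mul_add, Matrix.add_mul]
  · simp only [Matrix.conjTranspose_kronecker, ← Matrix.mul_kronecker_mul]
    rw [tensor_kronecker, hΦ.2, hΨ.2]
    ext ⟨a, c⟩ ⟨a', c'⟩
    simp only [Matrix.sum_apply, Matrix.kroneckerMap_apply, Fintype.sum_prod_type,
      Finset.sum_mul_sum]

lemma IsChannel.tensor {Φ : SuperOp A B} {Ψ : SuperOp C D} (hΦ : IsChannel Φ)
    (hΨ : IsChannel Ψ) : IsChannel (tensor Φ Ψ) := by
  obtain ⟨_, K, hK⟩ := hΦ.exists_isKraus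
  obtain ⟨_, L, hL⟩ := hΨ.exists_isKraus
  exact (hK.tensor hL).isChannel

lemma isKraus_id : IsKraus (LinearMap.id : SuperOp A A) fun _ : Unit => 1 :=
  ⟨by simp, fun ρ => by simp⟩

lemma IsKraus.tensor_id {Φ : SuperOp A B} {K : ι → Matrix B A ℂ} (hΦ : IsKraus Φ K) :
    IsKraus (QInfo.tensor Φ (LinearMap.id : SuperOp D D)) fun e => K e ⊗ₖ (1 : Matrix D D ℂ) := by
  obtain ⟨h1, h2⟩ := hΦ.tensor (isKraus_id (A := D))
  simp only [Fintype.sum_prod_type, Finset.univ_unique, Finset.sum_singleton] at h1 h2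
  exact ⟨h1, h2⟩

lemma erasure_apply (p : ℝ) (d : ℕ) (ρ : Matrix (Fin d) (Fin d) ℂ) : erasure p d ρ =
    ((1 - p : ℝ) : ℂ) • (flagInclusion (Fin d) * ρ * (flagInclusion (Fin d))ᴴ) +
      ((p : ℂ) * ρ.trace) • Matrix.single none none 1 := rfl

/-- The Kraus operators `√(1-p) ι` and `√p |e⟩⟨i|` of the erasure channel. -/
lemma isKraus_erasure {p : ℝ} (hp0 : 0 ≤ p) (hp1 : p ≤ 1) (d : ℕ) :
    IsKraus (erasure p d) fun e : Option (Fin d) => e.elim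
      (((√(1 - p) : ℝ) : ℂ) • flagInclusion (Fin d))
      fun i => ((√p : ℝ) : ℂ) • Matrix.single none i (1 : ℂ) := by
  have h1 : ((√(1 - p) : ℝ) : ℂ) * ((√(1 - p) : ℝ) : ℂ) = ((1 - p : ℝ) : ℂ) := by
    rw [← Complex.ofReal_mul, Real.mul_self_sqrt (by linarith)]
  have h2 : ((√p : ℝ) : ℂ) * ((√p : ℝ) : ℂ) = (p : ℂ) := by
    rw [← Complex.ofReal_mul, Real.mul_self_sqrt hp0]
  have h3 : (flagInclusion (Fin d))ᴴ * flagInclusion (Fin d) = 1 := by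
    ext i j
    simp [flagInclusion, Matrix.mul_apply, Matrix.one_apply, eq_comm]
  constructor
  · simp only [Fintype.sum_option, Option.elim_none, Option.elim_some, Matrix.conjTranspose_smul,
      Matrix.smul_mul, Matrix.mul_smul, smul_smul, Complex.star_def, Complex.conj_ofReal, h1, h2,
      h3, Matrix.conjTranspose_single, star_one, Matrix.single_mul_single_same, mul_one,
      ← Finset.smul_sum, Matrix.sum_single_one]
    rw [← add_smul, ← Complex.ofReal_add, sub_add_cancel, Complex.ofReal_one, one_smul]
  · intro ρ
    simp only [Fintype.sum_option, Option.elim_none, Option.elim_some, Matrix.conjTranspose_smul,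
      Matrix.smul_mul, Matrix.mul_smul, smul_smul, Complex.star_def, Complex.conj_ofReal, h1, h2,
      Matrix.conjTranspose_single, star_one, ← Finset.smul_sum]
    rw [erasure_apply, mul_smul]
    congr 2
    ext i j
    simp [Matrix.sum_apply, Matrix.single_mul_mul_single, Matrix.trace, Matrix.single_apply]

/-- Conjugating a channel by relabellings of the two computational bases. -/
lemma IsChannel.reindex {A' B' : Type*} [Fintype A'] [Fintype B'] [DecidableEq A'] [DecidableEq B']
    {Φ : SuperOp A B} (hΦ : IsChannel Φ) {Φ' : SuperOp A' B'} (eA : A ≃ A') (eB : B ≃ B')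
    (h : ∀ ρ, Φ' (ρ.submatrix eA.symm eA.symm) = (Φ ρ).submatrix eB.symm eB.symm) :
    IsChannel Φ' := by
  obtain ⟨r, K, hK, hΦ⟩ := hΦ.exists_isKraus
  refine IsKraus.isChannel (K := fun e => (K e).submatrix eB.symm eA.symm) ⟨?_, fun ρ => ?_⟩
  · have := congrArg (fun M => M.submatrix eA.symm eA.symm) hK
    ext a a'
    have := congrFun (congrFun this a) a'
    simp only [Matrix.submatrix_apply, Matrix.sum_apply, Matrix.mul_apply] at this
    simp only [Matrix.sum_apply, Matrix.mul_apply, Matrix.conjTranspose_apply,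
      Matrix.submatrix_apply]
    rw [Finset.sum_congr rfl fun e _ =>
      eB.symm.sum_comp fun b => star (K e b (eA.symm a)) * K e b (eA.symm a')]
    simpa [Matrix.one_apply] using this
  · have h2 : ρ = (ρ.submatrix eA eA).submatrix eA.symm eA.symm := by simp
    rw [h2, h, hΦ]
    simp only [Matrix.conjTranspose_submatrix, Matrix.submatrix_mul_equiv]
    ext b b'
    simp [Matrix.sum_apply]

end Channels

/-! ### The classical information as a Holevo quantity -/

section Holevo

variable {A B ι : Type*} [Fintype A] [Fintype B] [Fintype ι]
  [DecidableEq A] [DecidableEq B]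

/-- Ensembles of quantum signals: the state `ρ x` is sent with probability `p x`. -/
def IsEnsemble {A ι : Type*} [Fintype A] [Fintype ι] (p : ι → ℝ) (ρ : ι → Matrix A A ℂ) : Prop :=
  (∀ x, 0 ≤ p x) ∧ ∑ x, p x = 1 ∧ ∀ x, IsState (ρ x)

/-- The Holevo quantity `H(Φ(∑ p_x ρ_x)) - ∑ p_x H(Φ(ρ_x))` of the ensemble of outputs. -/
def holevo {A B ι : Type*} [Fintype B] [DecidableEq B] [Fintype ι] (Φ : SuperOp A B) (p : ι → ℝ)
    (ρ : ι → Matrix A A ℂ) : ℝ :=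
  entropy (Φ (∑ x, (p x : ℂ) • ρ x)) - ∑ x, p x * entropy (Φ (ρ x))

lemma IsEnsemble.isState {A ι : Type*} [Fintype A] [Fintype ι] {p : ι → ℝ} {ρ : ι → Matrix A A ℂ}
    (h : IsEnsemble p ρ) : IsState (∑ x, (p x : ℂ) • ρ x) := by
  refine ⟨posSemidef_sum_smul h.1 fun x => (h.2.2 x).1, ?_⟩
  rw [Matrix.trace_sum]
  simp only [Matrix.trace_smul, (h.2.2 _).2, smul_eq_mul, mul_one]
  rw [← Complex.ofReal_sum, h.2.1, Complex.ofReal_one]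

lemma mutualInfo_cq [DecidableEq ι] {p : ι → ℝ} {σ : ι → Matrix B B ℂ} (h : IsEnsemble p σ) :
    mutualInfo (∑ x, (p x : ℂ) • (Matrix.single x x (1 : ℂ) ⊗ₖ σ x)) =
      entropy (∑ x, (p x : ℂ) • σ x) - ∑ x, p x * entropy (σ x) := by
  have hH : ∀ x, ((p x : ℂ) • σ x).IsHermitian := fun x =>
    isHermitian_ofReal_smul (h.2.2 x).1.isHermitian _
  have h1 : traceSnd (∑ x, (p x : ℂ) • (Matrix.single x x (1 : ℂ) ⊗ₖ σ x)) =
      Matrix.diagonal fun x => (p x : ℂ) := by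
    have htr : ∀ x, ∑ b, σ x b b = 1 := fun x => (h.2.2 x).2
    ext x y
    simp only [traceSnd, Matrix.of_apply, Matrix.sum_apply, Matrix.smul_apply,
      Matrix.kroneckerMap_apply, smul_eq_mul]
    rw [Finset.sum_comm]
    simp only [← Finset.mul_sum, htr, Matrix.single_apply, mul_one, Matrix.diagonal_apply]
    by_cases hxy : x = y
    · simp [hxy]
    · simp only [hxy, if_false]
      refine Finset.sum_eq_zero fun z _ => ?_
      rw [if_neg (fun hz => hxy (hz.1.symm.trans hz.2)), mul_zero]
  have h2 : traceFst (∑ x, (p x : ℂ) • (Matrix.single x x (1 : ℂ) ⊗ₖ σ x)) =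
      ∑ x, (p x : ℂ) • σ x := by
    ext b b'
    simp only [traceFst, Matrix.of_apply, Matrix.sum_apply, Matrix.smul_apply,
      Matrix.kroneckerMap_apply, smul_eq_mul]
    rw [Finset.sum_comm]
    simp [Matrix.single_apply]
  have h3 : ∑ x, (p x : ℂ) • (Matrix.single x x (1 : ℂ) ⊗ₖ σ x) =
      (Matrix.blockDiagonal fun x => (p x : ℂ) • σ x).submatrix
        (Equiv.prodComm B ι).symm (Equiv.prodComm B ι).symm := by
    ext ⟨x, b⟩ ⟨y, b'⟩
    simp only [Matrix.sum_apply, Matrix.smul_apply, Matrix.kroneckerMap_apply, smul_eq_mul,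
      Matrix.submatrix_apply, Equiv.prodComm_symm, Equiv.prodComm_apply, Prod.swap_prod_mk,
      Matrix.blockDiagonal_apply, Matrix.single_apply]
    by_cases hxy : x = y
    · simp [hxy]
    · simp only [hxy, if_false]
      refine Finset.sum_eq_zero fun z _ => ?_
      rw [if_neg (fun hz => hxy (hz.1.symm.trans hz.2)), zero_mul, mul_zero]
  have hB : (Matrix.blockDiagonal fun x => (p x : ℂ) • σ x).IsHermitian := by
    rw [Matrix.IsHermitian, Matrix.blockDiagonal_conjTranspose]
    congr 1; ext1 k; exact hH k
  rw [mutualInfo, h1, h2, h3, entropy_reindex _ hB, entropy_blockDiagonal hH, entropy_diagonal]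
  simp only [entropy_smul (h.2.2 _).1.isHermitian, (h.2.2 _).2, Complex.one_re, mul_one,
    Finset.sum_add_distrib, ← Finset.sum_div]
  ring

lemma IsEnsemble.map {Φ : SuperOp A B} (hΦ : IsChannel Φ) {p : ι → ℝ} {ρ : ι → Matrix A A ℂ}
    (h : IsEnsemble p ρ) : IsEnsemble p fun x => Φ (ρ x) :=
  ⟨h.1, h.2.1, fun x => hΦ.isState (h.2.2 x)⟩

lemma mutualInfo_tensor_id [DecidableEq ι] {Φ : SuperOp A B} (hΦ : IsChannel Φ) {p : ι → ℝ}
    {ρ : ι → Matrix A A ℂ} (h : IsEnsemble p ρ) :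
    mutualInfo (tensor (LinearMap.id : SuperOp ι ι) Φ
      (∑ x, (p x : ℂ) • (Matrix.single x x (1 : ℂ) ⊗ₖ ρ x))) = holevo Φ p ρ := by
  simp only [map_sum, map_smul, tensor_kronecker, LinearMap.id_apply]
  rw [mutualInfo_cq (h.map hΦ), holevo]
  simp only [map_sum, map_smul]

lemma mem_infoValues {Φ : SuperOp A B} (hΦ : IsChannel Φ) {v : ℝ} :
    v ∈ infoValues Φ ↔ ∃ (m : ℕ) (p : Fin m → ℝ) (ρ : Fin m → Matrix A A ℂ),
      IsEnsemble p ρ ∧ v = holevo Φ p ρ := by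
  constructor
  · rintro ⟨m, σ, ⟨p, ρ, h0, h1, h2, rfl⟩, rfl⟩
    exact ⟨m, p, ρ, ⟨h0, h1, h2⟩, mutualInfo_tensor_id hΦ ⟨h0, h1, h2⟩⟩
  · rintro ⟨m, p, ρ, h, rfl⟩
    exact ⟨m, _, ⟨p, ρ, h.1, h.2.1, h.2.2, rfl⟩, (mutualInfo_tensor_id hΦ h).symm⟩

lemma IsEnsemble.holevo_mem {Φ : SuperOp A B} (hΦ : IsChannel Φ) {p : ι → ℝ}
    {ρ : ι → Matrix A A ℂ} (h : IsEnsemble p ρ) : holevo Φ p ρ ∈ infoValues Φ := by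
  let f := (Fintype.equivFin ι).symm
  refine (mem_infoValues hΦ).2 ⟨_, p ∘ f, ρ ∘ f,
    ⟨fun x => h.1 _, (f.sum_comp p).trans h.2.1, fun x => h.2.2 _⟩, ?_⟩
  simp only [holevo, Function.comp_apply]
  rw [f.sum_comp fun x => (p x : ℂ) • ρ x, f.sum_comp fun x => p x * entropy (Φ (ρ x))]

lemma infoValues_reindex_subset {A' B' : Type*} [Fintype A'] [Fintype B'] [DecidableEq A']
    [DecidableEq B'] {Φ : SuperOp A B} (hΦ : IsChannel Φ) {Φ' : SuperOp A' B'} (eA : A ≃ A')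
    (eB : B ≃ B')
    (h : ∀ ρ, Φ' (ρ.submatrix eA.symm eA.symm) = (Φ ρ).submatrix eB.symm eB.symm) :
    infoValues Φ ⊆ infoValues Φ' := by
  intro v hv
  obtain ⟨m, p, ρ, hρ, rfl⟩ := (mem_infoValues hΦ).1 hv
  refine (mem_infoValues (hΦ.reindex eA eB h)).2
    ⟨m, p, fun x => (ρ x).submatrix eA.symm eA.symm, ⟨hρ.1, hρ.2.1, fun x => ?_⟩, ?_⟩
  · refine ⟨(hρ.2.2 x).1.submatrix _, ?_⟩
    rw [← (hρ.2.2 x).2]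
    exact eA.symm.sum_comp fun a => ρ x a a
  · have : ∑ x, (p x : ℂ) • (ρ x).submatrix eA.symm eA.symm =
        (∑ x, (p x : ℂ) • ρ x).submatrix eA.symm eA.symm := by
      ext a a'; simp [Matrix.sum_apply]
    simp only [holevo]
    rw [this, h, entropy_reindex _ (hΦ.isState hρ.isState).1.isHermitian]
    simp only [h, entropy_reindex _ (hΦ.isState (hρ.2.2 _)).1.isHermitian]

lemma infoValues_reindex {A' B' : Type*} [Fintype A'] [Fintype B'] [DecidableEq A']
    [DecidableEq B'] {Φ : SuperOp A B} (hΦ : IsChannel Φ) {Φ' : SuperOp A' B'} (eA : A ≃ A')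
    (eB : B ≃ B')
    (h : ∀ ρ, Φ' (ρ.submatrix eA.symm eA.symm) = (Φ ρ).submatrix eB.symm eB.symm) :
    infoValues Φ' = infoValues Φ := by
  refine (infoValues_reindex_subset (hΦ.reindex eA eB h) eA.symm eB.symm fun ρ => ?_).antisymm
    (infoValues_reindex_subset hΦ eA eB h)
  have := h (ρ.submatrix eA eA)
  simp only [Matrix.submatrix_submatrix, Equiv.self_comp_symm, Matrix.submatrix_id_id] at this
  simp [this]

end Holevo

/-! ### Attainment of the classical information -/

section Attainment

variable {A B ι : Type*} [Fintype A] [Fintype B] [Fintype ι] [DecidableEq A] [DecidableEq B]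

/-- The rank one operator `|v⟩⟨v|`. -/
def proj {A : Type*} (v : A → ℂ) : Matrix A A ℂ := Matrix.vecMulVec v (star v)

lemma isState_proj {v : A → ℂ} (hv : v ⬝ᵥ star v = 1) : IsState (proj v) :=
  ⟨Matrix.posSemidef_vecMulVec_self_star v, by rw [proj, Matrix.trace_vecMulVec, hv]⟩

/-- The states are the image of the Hilbert-Schmidt unit sphere under `K ↦ K Kᴴ`. -/
lemma isCompact_isState : IsCompact {ρ : Matrix A A ℂ | IsState ρ} := by
  let S : Set (A → A → ℂ) := {K | ∑ i, ∑ j, ‖K i j‖ ^ 2 = 1}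
  have hS : IsCompact S := by
    refine (isCompact_closedBall (0 : A → A → ℂ) 1).of_isClosed_subset
      (isClosed_eq (by fun_prop) continuous_const) fun K hK => ?_
    rw [mem_closedBall_zero_iff, pi_norm_le_iff_of_nonneg zero_le_one]
    refine fun i => (pi_norm_le_iff_of_nonneg zero_le_one).2 fun j => ?_
    have h1 : ‖K i j‖ ^ 2 ≤ ∑ j, ‖K i j‖ ^ 2 :=
      Finset.single_le_sum (f := fun j => ‖K i j‖ ^ 2) (fun _ _ => by positivity)
        (Finset.mem_univ j)
    have h2 : ∑ j, ‖K i j‖ ^ 2 ≤ ∑ i, ∑ j, ‖K i j‖ ^ 2 :=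
      Finset.single_le_sum (f := fun i => ∑ j, ‖K i j‖ ^ 2) (fun _ _ => by positivity)
        (Finset.mem_univ i)
    have h3 : ∑ i, ∑ j, ‖K i j‖ ^ 2 = 1 := hK
    exact (sq_le_one_iff₀ (norm_nonneg _)).1 (by linarith)
  have hf : Continuous fun K : Matrix A A ℂ => K * Kᴴ :=
    continuous_id.matrix_mul continuous_id.matrix_conjTranspose
  have htr : ∀ K : Matrix A A ℂ, (K * Kᴴ).trace = ((∑ i, ∑ j, ‖K i j‖ ^ 2 : ℝ) : ℂ) := by
    intro K
    simp [Matrix.trace, Matrix.mul_apply, Complex.mul_conj']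
  convert hS.image hf using 1
  ext ρ
  constructor
  · rintro ⟨h, h1⟩
    have hH := h.isHermitian
    obtain ⟨K, hK⟩ : ∃ K : Matrix A A ℂ, ρ = K * Kᴴ := by
      refine ⟨(hH.eigenvectorUnitary : Matrix A A ℂ) *
        Matrix.diagonal fun i => ((√(hH.eigenvalues i) : ℝ) : ℂ), ?_⟩
      conv_lhs => rw [eq_eigenvectorUnitary_conj hH]
      rw [Matrix.conjTranspose_mul, Matrix.mul_assoc, Matrix.mul_assoc,
        Matrix.diagonal_conjTranspose, ← Matrix.mul_assoc (Matrix.diagonal _) (Matrix.diagonal _),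
        Matrix.diagonal_mul_diagonal]
      congr 3
      ext i
      simp only [Pi.star_apply, Complex.star_def, Complex.conj_ofReal]
      rw [← Complex.ofReal_mul, Real.mul_self_sqrt (h.eigenvalues_nonneg i)]
    refine ⟨K, ?_, hK.symm⟩
    rw [hK, htr] at h1
    exact_mod_cast h1
  · rintro ⟨K, hK, rfl⟩
    refine ⟨Matrix.posSemidef_self_mul_conjTranspose K, ?_⟩
    have h3 : ∑ i, ∑ j, ‖K i j‖ ^ 2 = 1 := hK
    have h4 := htr K
    rw [h3, Complex.ofReal_one] at h4
    exact h4

lemma exists_isState [Nonempty A] : ∃ ρ : Matrix A A ℂ, IsState ρ := by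
  obtain ⟨a⟩ := ‹Nonempty A›
  exact ⟨proj (Pi.single a 1), isState_proj (by simp)⟩

lemma IsChannel.continuousOn_entropy {Φ : SuperOp A B} (hΦ : IsChannel Φ) :
    ContinuousOn (fun ρ => entropy (Φ ρ)) {ρ | IsState ρ} :=
  QInfo.continuousOn_entropy.comp
    (t := {ρ : Matrix B B ℂ | ρ.IsHermitian})
    (LinearMap.continuous_of_finiteDimensional Φ).continuousOn
    fun _ hρ => (hΦ.isState hρ).1.isHermitian

/-- The number of signals that suffices by Carathéodory's theorem: one more than the dimension of
the space of the points `(ρ_x, H(Φ(ρ_x)))`. -/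
def signalBound (A : Type*) [Fintype A] : ℕ := Module.finrank ℝ (Matrix A A ℂ × ℝ) + 1

/-- The Holevo quantity depends only on the barycentre of the points `(ρ_x, H(Φ(ρ_x)))`, so that
Carathéodory's theorem bounds the number of signals. -/
lemma IsEnsemble.exists_signalBound {Φ : SuperOp A B} {p : ι → ℝ}
    {ρ : ι → Matrix A A ℂ} (h : IsEnsemble p ρ) :
    ∃ (q : Fin (signalBound A) → ℝ) (σ : Fin (signalBound A) → Matrix A A ℂ),
      IsEnsemble q σ ∧ holevo Φ p ρ = holevo Φ q σ := by
  let f : Matrix A A ℂ → Matrix A A ℂ × ℝ := fun ρ => (ρ, entropy (Φ ρ))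
  have hmem : ∑ x, p x • f (ρ x) ∈ convexHull ℝ (f '' {ρ | IsState ρ}) :=
    (convex_convexHull ℝ _).sum_mem (fun x _ => h.1 x) h.2.1 fun x _ =>
      subset_convexHull ℝ _ ⟨_, h.2.2 x, rfl⟩
  obtain ⟨κ, _, z, w, hz, hind, hw, hw1, hsum⟩ := eq_pos_convex_span_of_mem_convexHull hmem
  have hz' : ∀ k, ∃ σ, IsState σ ∧ f σ = z k := fun k => hz ⟨k, rfl⟩
  choose τ hτ hfτ using hz'
  have hcard : Fintype.card κ ≤ Fintype.card (Fin (signalBound A)) := by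
    rw [Fintype.card_fin]
    exact hind.card_le_finrank_succ.trans (Nat.succ_le_succ (Submodule.finrank_le _))
  obtain ⟨g⟩ := Function.Embedding.nonempty_of_card_le hcard
  obtain ⟨ρ₀, hρ₀⟩ : ∃ ρ₀ : Matrix A A ℂ, IsState ρ₀ := ⟨_, h.isState⟩
  set q := Function.extend g w 0 with hq
  set σ := Function.extend g τ fun _ => ρ₀ with hσ
  have hqg : ∀ k, q (g k) = w k := fun k => g.injective.extend_apply _ _ _
  have hσg : ∀ k, σ (g k) = τ k := fun k => g.injective.extend_apply _ _ _
  have hq0 : ∀ x, x ∉ Set.range g → q x = 0 := fun x hx => by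
    rw [hq, Function.extend_apply' _ _ _ (by simpa using hx), Pi.zero_apply]
  have key : ∑ x, q x • f (σ x) = ∑ k, w k • z k := by
    refine (Fintype.sum_of_injective g g.injective _ _ (fun x hx => ?_) fun k => ?_).symm
    · rw [hq0 x hx, zero_smul]
    · rw [hqg, hσg, hfτ]
  refine ⟨q, σ, ⟨fun x => ?_, ?_, fun x => ?_⟩, ?_⟩
  · by_cases hx : x ∈ Set.range g
    · obtain ⟨k, rfl⟩ := hx
      rw [hqg]; exact (hw k).le
    · exact (hq0 x hx).ge
  · rw [← hw1]
    exact (Fintype.sum_of_injective g g.injective _ _ hq0 fun k => (hqg k).symm).symm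
  · by_cases hx : x ∈ Set.range g
    · obtain ⟨k, rfl⟩ := hx
      rw [hσg]; exact hτ k
    · rw [hσ, Function.extend_apply' _ _ _ (by simpa using hx)]
      exact hρ₀
  · rw [hsum] at key
    have h1 := congrArg Prod.fst key
    have h2 := congrArg Prod.snd key
    simp only [f, Prod.fst_sum, Prod.snd_sum, Prod.smul_fst, Prod.smul_snd, smul_eq_mul] at h1 h2
    simp only [holevo, Complex.coe_smul]
    rw [h1, h2]

lemma IsChannel.continuousOn_holevo {Φ : SuperOp A B} (hΦ : IsChannel Φ) :
    ContinuousOn (fun x : (ι → ℝ) × (ι → Matrix A A ℂ) => holevo Φ x.1 x.2)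
      {x | IsEnsemble x.1 x.2} := by
  have hp : ∀ i, Continuous fun x : (ι → ℝ) × (ι → Matrix A A ℂ) => x.1 i :=
    fun i => (continuous_apply i).comp continuous_fst
  have hρ : ∀ i, Continuous fun x : (ι → ℝ) × (ι → Matrix A A ℂ) => x.2 i :=
    fun i => (continuous_apply i).comp continuous_snd
  have hmix : Continuous fun x : (ι → ℝ) × (ι → Matrix A A ℂ) => ∑ i, (x.1 i : ℂ) • x.2 i :=
    continuous_finsetSum _ fun i _ => (Complex.continuous_ofReal.comp (hp i)).smul (hρ i)
  have h1 : ContinuousOn (fun x : (ι → ℝ) × (ι → Matrix A A ℂ) =>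
      entropy (Φ (∑ i, (x.1 i : ℂ) • x.2 i))) {x | IsEnsemble x.1 x.2} :=
    hΦ.continuousOn_entropy.comp hmix.continuousOn
      fun _ hx => IsEnsemble.isState hx
  have h2 : ∀ i, ContinuousOn (fun x : (ι → ℝ) × (ι → Matrix A A ℂ) => entropy (Φ (x.2 i)))
      {x | IsEnsemble x.1 x.2} := fun i =>
    hΦ.continuousOn_entropy.comp (hρ i).continuousOn fun _ hx => hx.2.2 i
  exact h1.sub (continuousOn_finsetSum _ fun i _ => (hp i).continuousOn.mul (h2 i))

lemma IsChannel.isGreatest_classicalInfo [Nonempty A] {Φ : SuperOp A B} (hΦ : IsChannel Φ) :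
    IsGreatest (infoValues Φ) (classicalInfo Φ) := by
  obtain ⟨n, hn0, hn⟩ : ∃ n, 0 < n ∧ n = signalBound A := ⟨_, Nat.succ_pos _, rfl⟩
  let K : Set ((Fin n → ℝ) × (Fin n → Matrix A A ℂ)) := {x | IsEnsemble x.1 x.2}
  have hKeq : K = stdSimplex ℝ (Fin n) ×ˢ Set.pi Set.univ fun _ => {ρ | IsState ρ} := by
    ext x
    simp only [K, IsEnsemble, Set.mem_ofPred_eq, Set.mem_prod, stdSimplex, Set.mem_pi,
      Set.mem_univ, true_implies, and_assoc]
  have hK : IsCompact K := by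
    rw [hKeq]
    exact (isCompact_stdSimplex ℝ _).prod (isCompact_univ_pi fun _ => isCompact_isState)
  have hne : K.Nonempty := by
    obtain ⟨ρ, hρ⟩ := exists_isState (A := A)
    refine ⟨(Pi.single ⟨0, hn0⟩ 1, fun _ => ρ), fun x => ?_, by simp, fun _ => hρ⟩
    exact (Pi.single_nonneg (α := fun _ => ℝ)).2 zero_le_one x
  have hcont : ContinuousOn (fun x : (Fin n → ℝ) × (Fin n → Matrix A A ℂ) =>
      holevo Φ x.1 x.2) K := hΦ.continuousOn_holevo
  obtain ⟨x, hx, hmax⟩ := hK.exists_isMaxOn hne hcont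
  have hgr : IsGreatest (infoValues Φ) (holevo Φ x.1 x.2) := by
    refine ⟨hx.holevo_mem hΦ, fun v hv => ?_⟩
    obtain ⟨m, p, ρ, h, rfl⟩ := (mem_infoValues hΦ).1 hv
    obtain ⟨q, σ, h', heq⟩ := h.exists_signalBound (Φ := Φ)
    subst hn
    rw [heq]
    exact isMaxOn_iff.1 hmax (q, σ) h'
  rwa [classicalInfo, hgr.csSup_eq]

end Attainment

/-! ### Adding a noiseless channel -/

section Noiseless

variable {A B D ι κ : Type*} [Fintype A] [Fintype B] [Fintype D] [Fintype ι] [Fintype κ]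
  [DecidableEq A] [DecidableEq B] [DecidableEq D]

/-- The amplitudes of the Stinespring dilation `∑ e, K e v ⊗ |e⟩` of the vector `v`, as a matrix
between output and environment. -/
def amplitude {A B κ : Type*} [Fintype A] (K : κ → Matrix B A ℂ) (v : A → ℂ) : Matrix B κ ℂ :=
  Matrix.of fun b e => (K e *ᵥ v) b

lemma IsKraus.map_proj {Φ : SuperOp A B} {K : κ → Matrix B A ℂ} (hK : IsKraus Φ K) (v : A → ℂ) :
    Φ (proj v) = amplitude K v * (amplitude K v)ᴴ := by
  rw [hK.2]
  ext b b'
  rw [Matrix.sum_apply, Matrix.mul_apply]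
  refine Finset.sum_congr rfl fun e _ => ?_
  rw [proj, Matrix.mul_vecMulVec, Matrix.vecMulVec_mul, ← Matrix.star_mulVec]
  rfl

/-- A normalization of `v`, arbitrary for `v = 0`. -/
lemma exists_unit_smul [Nonempty A] (v : A → ℂ) : ∃ u : A → ℂ, u ⬝ᵥ star u = 1 ∧
    v = ((√(∑ a, ‖v a‖ ^ 2) : ℝ) : ℂ) • u := by
  have hdot : ∀ w : A → ℂ, w ⬝ᵥ star w = ((∑ a, ‖w a‖ ^ 2 : ℝ) : ℂ) := by
    intro w
    simp [dotProduct, Complex.mul_conj']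
  set q := ∑ a, ‖v a‖ ^ 2 with hq
  have hq0 : 0 ≤ q := Finset.sum_nonneg fun _ _ => by positivity
  rcases hq0.eq_or_lt with h | h
  · obtain ⟨a⟩ := ‹Nonempty A›
    refine ⟨Pi.single a 1, by simp, ?_⟩
    have := (Finset.sum_eq_zero_iff_of_nonneg (fun a _ => sq_nonneg ‖v a‖)).1 h.symm
    ext b
    simpa [← h] using this b (Finset.mem_univ b)
  · have hs : ((√q : ℝ) : ℂ) ≠ 0 := by exact_mod_cast (Real.sqrt_pos.2 h).ne'
    refine ⟨((√q : ℝ) : ℂ)⁻¹ • v, ?_, by rw [smul_smul, mul_inv_cancel₀ hs, one_smul]⟩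
    rw [star_smul, smul_dotProduct, dotProduct_smul, hdot, ← hq, smul_eq_mul, smul_eq_mul,
      Complex.star_def, map_inv₀, Complex.conj_ofReal]
    nth_rewrite 3 [← Real.mul_self_sqrt hq0]
    rw [Complex.ofReal_mul]
    field_simp

lemma proj_smul (r : ℝ) (v : A → ℂ) : proj ((r : ℂ) • v) = ((r ^ 2 : ℝ) : ℂ) • proj v := by
  ext a b
  simp [proj, Matrix.vecMulVec_apply]
  ring

/-- The output `BD` and the environment of `Φ` have the same entropy on a pure input, and the
environment state is the mixture of those for the pure inputs to `Φ` that a measurement of `D`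
leaves behind. -/
lemma exists_ensemble_of_proj [Nonempty A] {Φ : SuperOp A B} (hΦ : IsChannel Φ) {v : A × D → ℂ}
    (hv : v ⬝ᵥ star v = 1) : ∃ (q : D → ℝ) (τ : D → Matrix A A ℂ), IsEnsemble q τ ∧
      ∑ k, (q k : ℂ) • τ k = traceSnd (proj v) ∧
      ∑ k, q k * entropy (Φ (τ k)) ≤
        entropy (tensor Φ (LinearMap.id : SuperOp D D) (proj v)) := by
  classical
  obtain ⟨r, K, hK⟩ := hΦ.exists_isKraus
  choose u hu huv using fun k : D => exists_unit_smul fun a => v (a, k)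
  set q : D → ℝ := fun k => ∑ a, ‖v (a, k)‖ ^ 2 with hq
  have hq0 : ∀ k, 0 ≤ q k := fun k => Finset.sum_nonneg fun _ _ => by positivity
  have hslice : ∀ k, (q k : ℂ) • proj (u k) = proj fun a => v (a, k) := by
    intro k
    rw [huv k, proj_smul, Real.sq_sqrt (hq0 k)]
  have hq1 : ∑ k, q k = 1 := by
    have : ((∑ k, q k : ℝ) : ℂ) = 1 := by
      rw [← hv]
      simp [hq, dotProduct, Complex.mul_conj', Fintype.sum_prod_type_right]
    exact_mod_cast this
  refine ⟨q, fun k => proj (u k), ⟨hq0, hq1, fun k => isState_proj (hu k)⟩, ?_, ?_⟩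
  · simp only [hslice]
    ext a a'
    simp [traceSnd, proj, Matrix.sum_apply, Matrix.vecMulVec_apply]
  -- Up to transposition, `Tᴴ * T` is the environment state for the amplitudes `T`. It is the sum
  -- over the slices `v (·, k)`, each of them weighted by its squared norm.
  · have hamp : (amplitude (fun e => K e ⊗ₖ (1 : Matrix D D ℂ)) v)ᴴ *
        amplitude (fun e => K e ⊗ₖ (1 : Matrix D D ℂ)) v =
        ∑ k, (q k : ℂ) • ((amplitude K (u k))ᴴ * amplitude K (u k)) := by
      have h1 : ∀ k, (q k : ℂ) • ((amplitude K (u k))ᴴ * amplitude K (u k)) =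
          (amplitude K fun a => v (a, k))ᴴ * amplitude K fun a => v (a, k) := by
        intro k
        have h2 : (amplitude K fun a => v (a, k)) = ((√(q k) : ℝ) : ℂ) • amplitude K (u k) := by
          rw [huv k]
          ext b e
          simp [amplitude, Matrix.mulVec_smul, hq]
        rw [h2, Matrix.conjTranspose_smul, Matrix.smul_mul, Matrix.mul_smul, smul_smul,
          Complex.star_def, Complex.conj_ofReal, ← Complex.ofReal_mul,
          Real.mul_self_sqrt (hq0 k)]
      have h3 : ∀ b k e, ((K e ⊗ₖ (1 : Matrix D D ℂ)) *ᵥ v) (b, k) =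
          (K e *ᵥ fun a => v (a, k)) b := by
        intro b k e
        simp [Matrix.mulVec, dotProduct, Fintype.sum_prod_type, Matrix.one_apply]
      simp only [h1]
      ext e e'
      simp only [Matrix.sum_apply, Matrix.mul_apply, Matrix.conjTranspose_apply, amplitude,
        Matrix.of_apply, Fintype.sum_prod_type_right, h3]
    rw [(hK.tensor_id (D := D)).map_proj, entropy_mul_conjTranspose_self, hamp]
    simp only [hK.map_proj, entropy_mul_conjTranspose_self]
    exact entropy_concave hq0 hq1 fun k => Matrix.posSemidef_conjTranspose_mul_self _

lemma eq_sum_eigenvalues_smul_proj {ρ : Matrix A A ℂ} (hρ : ρ.IsHermitian) :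
    ρ = ∑ k, (hρ.eigenvalues k : ℂ) •
      proj fun a => (hρ.eigenvectorUnitary : Matrix A A ℂ) a k := by
  conv_lhs => rw [eq_eigenvectorUnitary_conj hρ]
  ext a b
  rw [Matrix.mul_apply, Matrix.sum_apply]
  refine Finset.sum_congr rfl fun k _ => ?_
  rw [Matrix.mul_diagonal, Matrix.conjTranspose_apply]
  simp [proj, Matrix.vecMulVec_apply]
  ring

lemma traceSnd_sum_smul {A D ι : Type*} [Fintype D] [Fintype ι] (c : ι → ℂ)
    (σ : ι → Matrix (A × D) (A × D) ℂ) :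
    traceSnd (∑ x, c x • σ x) = ∑ x, c x • traceSnd (σ x) := by
  ext a a'
  simp only [traceSnd, Matrix.of_apply, Matrix.sum_apply, Matrix.smul_apply, smul_eq_mul,
    Finset.mul_sum]
  exact Finset.sum_comm

lemma IsState.traceSnd {ρ : Matrix (A × D) (A × D) ℂ} (hρ : IsState ρ) :
    IsState (traceSnd ρ) :=
  ⟨traceSnd_posSemidef hρ.1, (trace_traceSnd ρ).trans hρ.2⟩

/-- The reduction of a mixed signal to pure ones, by concavity of the entropy. -/
lemma exists_ensemble_of_isState [Nonempty A] {Φ : SuperOp A B} (hΦ : IsChannel Φ)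
    {ρ : Matrix (A × D) (A × D) ℂ} (hρ : IsState ρ) :
    ∃ (q : (A × D) × D → ℝ) (τ : (A × D) × D → Matrix A A ℂ), IsEnsemble q τ ∧
      ∑ k, (q k : ℂ) • τ k = traceSnd ρ ∧
      ∑ k, q k * entropy (Φ (τ k)) ≤ entropy (tensor Φ (LinearMap.id : SuperOp D D) ρ) := by
  have hH := hρ.1.isHermitian
  set l := hH.eigenvalues with hl
  set v : A × D → A × D → ℂ := fun k x => (hH.eigenvectorUnitary : Matrix _ _ ℂ) x k with hv
  have hdec : ρ = ∑ k, (l k : ℂ) • proj (v k) := eq_sum_eigenvalues_smul_proj hH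
  have hl0 : ∀ k, 0 ≤ l k := hρ.1.eigenvalues_nonneg
  have hl1 : ∑ k, l k = 1 := by
    have : ρ.trace = ∑ a, (hH.eigenvalues a : ℂ) := hH.trace_eq_sum_eigenvalues
    rw [hρ.2] at this
    exact_mod_cast this.symm
  have hunit : ∀ k, v k ⬝ᵥ star (v k) = 1 := by
    intro k
    have : (star (hH.eigenvectorUnitary : Matrix (A × D) (A × D) ℂ) *
        (hH.eigenvectorUnitary : Matrix (A × D) (A × D) ℂ)) k k =
        (1 : Matrix (A × D) (A × D) ℂ) k k :=
      congrFun (congrFun (Unitary.coe_star_mul_self hH.eigenvectorUnitary) k) k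
    rw [Matrix.star_eq_conjTranspose, Matrix.mul_apply, Matrix.one_apply_eq] at this
    rw [dotProduct_comm, ← this]
    rfl
  choose q τ hens htr hent using fun k => exists_ensemble_of_proj hΦ (hunit k)
  refine ⟨fun x => l x.1 * q x.1 x.2, fun x => τ x.1 x.2, ⟨fun x => ?_, ?_, fun x => ?_⟩, ?_, ?_⟩
  · exact mul_nonneg (hl0 _) ((hens _).1 _)
  · simp only [Fintype.sum_prod_type (f := fun x : (A × D) × D => l x.1 * q x.1 x.2),
      ← Finset.mul_sum, (hens _).2.1, mul_one, hl1]
  · exact (hens _).2.2 _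
  · rw [Fintype.sum_prod_type]
    simp only [Complex.ofReal_mul, mul_smul, ← Finset.smul_sum, htr]
    conv_rhs => rw [hdec]
    rw [traceSnd_sum_smul]
  · rw [Fintype.sum_prod_type]
    simp only [mul_assoc, ← Finset.mul_sum]
    have hpos : ∀ k, (tensor Φ (LinearMap.id : SuperOp D D) (proj (v k))).PosSemidef := fun k =>
      (hΦ.tensor isKraus_id.isChannel).posSemidef (isState_proj (hunit k)).1
    calc ∑ k, l k * ∑ j, q k j * entropy (Φ (τ k j))
        ≤ ∑ k, l k * entropy (tensor Φ (LinearMap.id : SuperOp D D) (proj (v k))) :=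
          Finset.sum_le_sum fun k _ => mul_le_mul_of_nonneg_left (hent k) (hl0 k)
      _ ≤ entropy (∑ k, (l k : ℂ) • tensor Φ (LinearMap.id : SuperOp D D) (proj (v k))) :=
          entropy_concave hl0 hl1 hpos
      _ = _ := by
          conv_rhs => rw [hdec]
          simp only [map_sum, map_smul]

lemma traceSnd_add {A : Type*} (ρ σ : Matrix (A × D) (A × D) ℂ) :
    traceSnd (ρ + σ) = traceSnd ρ + traceSnd σ := by
  ext a a'
  simp [traceSnd, Finset.sum_add_distrib]

lemma traceSnd_zero {A : Type*} : traceSnd (0 : Matrix (A × D) (A × D) ℂ) = 0 := by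
  ext a a'
  simp [traceSnd]

lemma traceSnd_kronecker {A : Type*} (ρ : Matrix A A ℂ) (σ : Matrix D D ℂ) :
    traceSnd (ρ ⊗ₖ σ) = σ.trace • ρ := by
  ext a a'
  simp [traceSnd, Matrix.trace, ← Finset.mul_sum, mul_comm]

lemma traceSnd_tensor_id (Φ : SuperOp A B) (ρ : Matrix (A × D) (A × D) ℂ) :
    traceSnd (tensor Φ (LinearMap.id : SuperOp D D) ρ) = Φ (traceSnd ρ) := by
  refine kronecker_induction (P := fun ρ => traceSnd (tensor Φ (LinearMap.id : SuperOp D D) ρ) =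
    Φ (traceSnd ρ)) ?_ (fun ρ σ h h' => ?_) (fun ρ σ => ?_) ρ
  · rw [map_zero, traceSnd_zero, traceSnd_zero, map_zero]
  · rw [map_add, traceSnd_add, traceSnd_add, h, h', map_add]
  · rw [tensor_kronecker, traceSnd_kronecker, traceSnd_kronecker, map_smul, LinearMap.id_apply]

/-- A noiseless system adds at most its number of qubits to the Holevo quantity. -/
lemma holevo_tensor_id_le [Nonempty A] [Nonempty D] {Φ : SuperOp A B} (hΦ : IsChannel Φ) {c : ℝ}
    (hc : c ∈ upperBounds (infoValues Φ)) {p : ι → ℝ} {ρ : ι → Matrix (A × D) (A × D) ℂ}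
    (h : IsEnsemble p ρ) :
    holevo (tensor Φ (LinearMap.id : SuperOp D D)) p ρ ≤ c + Real.logb 2 (Fintype.card D) := by
  choose q τ hens htr hent using fun x => exists_ensemble_of_isState hΦ (h.2.2 x)
  have hbig : IsEnsemble (fun y : ι × ((A × D) × D) => p y.1 * q y.1 y.2) fun y => τ y.1 y.2 := by
    refine ⟨fun y => mul_nonneg (h.1 _) ((hens _).1 _), ?_, fun y => (hens _).2.2 _⟩
    rw [Fintype.sum_prod_type]
    simp only [← Finset.mul_sum, (hens _).2.1, mul_one, h.2.1]
  have h1 := hc (hbig.holevo_mem hΦ)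
  have h2 := entropy_le_entropy_traceSnd_add
    ((hΦ.tensor (isKraus_id (A := D)).isChannel).isState h.isState)
  have h3 : ∑ x, p x * ∑ k, q x k * entropy (Φ (τ x k)) ≤
      ∑ x, p x * entropy (tensor Φ (LinearMap.id : SuperOp D D) (ρ x)) :=
    Finset.sum_le_sum fun x _ => mul_le_mul_of_nonneg_left (hent x) (h.1 x)
  rw [traceSnd_tensor_id, traceSnd_sum_smul] at h2
  rw [holevo, Fintype.sum_prod_type, Fintype.sum_prod_type] at h1
  simp only [Complex.ofReal_mul, mul_smul, ← Finset.smul_sum, htr, mul_assoc,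
    ← Finset.mul_sum] at h1
  rw [holevo]
  linarith

end Noiseless

/-! ### Adding an erasure channel -/

section Erasure

variable {A B ι : Type*} [Fintype A] [Fintype B] [Fintype ι] [DecidableEq A] [DecidableEq B]

/-- Splitting the output of an erasure channel according to the flag. -/
def flagEquiv (B D : Type*) : (B × D) ⊕ B ≃ B × Option D where
  toFun := Sum.elim (fun y => (y.1, some y.2)) fun b => (b, none)
  invFun x := x.2.elim (Sum.inr x.1) fun k => Sum.inl (x.1, k)
  left_inv := by rintro (⟨b, k⟩ | b) <;> rfl
  right_inv := by rintro ⟨b, _ | k⟩ <;> rfl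

lemma erasure_some_some (p : ℝ) {d : ℕ} (σ : Matrix (Fin d) (Fin d) ℂ) (i j : Fin d) :
    erasure p d σ (some i) (some j) = ((1 - p : ℝ) : ℂ) * σ i j := by
  simp [erasure_apply, flagInclusion, Matrix.mul_apply]

lemma erasure_some_none (p : ℝ) {d : ℕ} (σ : Matrix (Fin d) (Fin d) ℂ) (i : Fin d) :
    erasure p d σ (some i) none = 0 := by
  simp [erasure_apply, flagInclusion, Matrix.mul_apply]

lemma erasure_none_some (p : ℝ) {d : ℕ} (σ : Matrix (Fin d) (Fin d) ℂ) (i : Fin d) :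
    erasure p d σ none (some i) = 0 := by
  simp [erasure_apply, flagInclusion, Matrix.mul_apply]

lemma erasure_none_none (p : ℝ) {d : ℕ} (σ : Matrix (Fin d) (Fin d) ℂ) :
    erasure p d σ none none = p * σ.trace := by
  simp [erasure_apply, flagInclusion, Matrix.mul_apply]

/-- The output is the orthogonal sum of the output of `Φ ⊗ id` with weight `1 - p` and of the
output of `Φ` on the marginal with weight `p`. -/
lemma tensor_erasure_apply (Φ : SuperOp A B) (p : ℝ) (d : ℕ)
    (ρ : Matrix (A × Fin d) (A × Fin d) ℂ) :
    tensor Φ (erasure p d) ρ =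
      (Matrix.fromBlocks (((1 - p : ℝ) : ℂ) • tensor Φ (LinearMap.id : SuperOp (Fin d) (Fin d)) ρ)
        0 0 ((p : ℂ) • Φ (traceSnd ρ))).submatrix (flagEquiv B (Fin d)).symm
          (flagEquiv B (Fin d)).symm := by
  refine kronecker_induction (P := fun ρ => tensor Φ (erasure p d) ρ =
      (Matrix.fromBlocks (((1 - p : ℝ) : ℂ) • tensor Φ (LinearMap.id : SuperOp (Fin d) (Fin d)) ρ)
        0 0 ((p : ℂ) • Φ (traceSnd ρ))).submatrix (flagEquiv B (Fin d)).symm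
          (flagEquiv B (Fin d)).symm) ?_ (fun ρ σ h h' => ?_) (fun ρ σ => ?_) ρ
  · simp [traceSnd_zero]
  · rw [map_add, h, h', map_add, traceSnd_add, map_add]
    ext ⟨b, _ | i⟩ ⟨b', _ | j⟩ <;> simp [flagEquiv]
  · rw [tensor_kronecker, tensor_kronecker, traceSnd_kronecker]
    ext ⟨b, _ | i⟩ ⟨b', _ | j⟩ <;>
      simp [flagEquiv, erasure_some_some, erasure_some_none, erasure_none_some,
        erasure_none_none] <;> ring

lemma entropy_tensor_erasure {Φ : SuperOp A B} (hΦ : IsChannel Φ) (p : ℝ) {d : ℕ}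
    {ρ : Matrix (A × Fin d) (A × Fin d) ℂ} (hρ : IsState ρ) :
    entropy (tensor Φ (erasure p d) ρ) =
      (1 - p) * entropy (tensor Φ (LinearMap.id : SuperOp (Fin d) (Fin d)) ρ) +
        p * entropy (Φ (traceSnd ρ)) + (negMulLog (1 - p) + negMulLog p) / Real.log 2 := by
  have h1 := (hΦ.tensor (isKraus_id (A := Fin d)).isChannel).isState hρ
  have h2 := hΦ.isState hρ.traceSnd
  have h3 := isHermitian_ofReal_smul h1.1.isHermitian (1 - p)
  have h4 := isHermitian_ofReal_smul h2.1.isHermitian p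
  rw [tensor_erasure_apply, entropy_reindex _ (h3.fromBlocks (by simp) h4),
    entropy_fromBlocks h3 h4, entropy_smul h1.1.isHermitian, entropy_smul h2.1.isHermitian,
    h1.2, h2.2, Complex.one_re]
  ring

lemma IsEnsemble.traceSnd {d : ℕ} {q : ι → ℝ} {ρ : ι → Matrix (A × Fin d) (A × Fin d) ℂ}
    (h : IsEnsemble q ρ) : IsEnsemble q fun x => traceSnd (ρ x) :=
  ⟨h.1, h.2.1, fun x => (h.2.2 x).traceSnd⟩

/-- The entropy of the flag is the same for all signals and cancels. -/
lemma holevo_tensor_erasure {Φ : SuperOp A B} (hΦ : IsChannel Φ) (p : ℝ) {d : ℕ} {q : ι → ℝ}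
    {ρ : ι → Matrix (A × Fin d) (A × Fin d) ℂ} (h : IsEnsemble q ρ) :
    holevo (tensor Φ (erasure p d)) q ρ =
      (1 - p) * holevo (tensor Φ (LinearMap.id : SuperOp (Fin d) (Fin d))) q ρ +
        p * holevo Φ q fun x => traceSnd (ρ x) := by
  simp only [holevo]
  rw [entropy_tensor_erasure hΦ p h.isState, traceSnd_sum_smul]
  simp only [entropy_tensor_erasure hΦ p (h.2.2 _), mul_add, Finset.sum_add_distrib,
    ← Finset.sum_mul, h.2.1, mul_left_comm _ (1 - p), mul_left_comm _ p, ← Finset.mul_sum]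
  ring

lemma entropy_kronecker_diagonal {D : Type*} [Fintype D] [DecidableEq D] {σ : Matrix B B ℂ}
    (hσ : IsState σ) {w : D → ℝ} (hw : ∑ k, w k = 1) :
    entropy (σ ⊗ₖ Matrix.diagonal fun k => (w k : ℂ)) =
      entropy σ + (∑ k, negMulLog (w k)) / Real.log 2 := by
  have hblock : σ ⊗ₖ Matrix.diagonal (fun k => (w k : ℂ)) =
      Matrix.blockDiagonal fun k => (w k : ℂ) • σ := by
    ext ⟨b, k⟩ ⟨b', l⟩
    by_cases hkl : k = l <;> simp [Matrix.blockDiagonal_apply, hkl, mul_comm]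
  rw [hblock, entropy_blockDiagonal fun k => isHermitian_ofReal_smul hσ.1.isHermitian _]
  simp only [entropy_smul hσ.1.isHermitian, hσ.2, Complex.one_re, mul_one, Finset.sum_add_distrib,
    ← Finset.sum_mul, ← Finset.sum_div, hw, one_mul]

/-- The uniform product signals `ρ_x ⊗ |j⟩⟨j|` gain the full `log d`. -/
lemma exists_holevo_tensor_erasure {Φ : SuperOp A B} (hΦ : IsChannel Φ) (p : ℝ) {d : ℕ}
    (hd : 1 ≤ d) {q : ι → ℝ} {ρ : ι → Matrix A A ℂ} (h : IsEnsemble q ρ) :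
    ∃ (q' : ι × Fin d → ℝ) (ρ' : ι × Fin d → Matrix (A × Fin d) (A × Fin d) ℂ),
      IsEnsemble q' ρ' ∧ holevo (tensor Φ (erasure p d)) q' ρ' =
        holevo Φ q ρ + (1 - p) * Real.logb 2 d := by
  have hd0 : (d : ℝ) ≠ 0 := by positivity
  have hunif : ∑ _k : Fin d, (d : ℝ)⁻¹ = 1 := by simp [hd0]
  have hsingle : ∀ j : Fin d, IsState (Matrix.single j j (1 : ℂ)) := by
    intro j
    have : proj (Pi.single j (1 : ℂ)) = Matrix.single j j (1 : ℂ) := by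
      rw [proj, Pi.star_single, star_one, Matrix.single_eq_single_vecMulVec_single]
    rw [← this]
    exact isState_proj (by simp)
  have htr : ∀ x : ι × Fin d,
      traceSnd (ρ x.1 ⊗ₖ Matrix.single x.2 x.2 (1 : ℂ)) = ρ x.1 := by
    intro x
    rw [traceSnd_kronecker, (hsingle x.2).2, one_smul]
  have hens : IsEnsemble (fun x : ι × Fin d => q x.1 * (d : ℝ)⁻¹)
      fun x => ρ x.1 ⊗ₖ Matrix.single x.2 x.2 (1 : ℂ) := by
    refine ⟨fun x => mul_nonneg (h.1 _) (by positivity), ?_, fun x =>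
      ⟨(h.2.2 x.1).1.kronecker (hsingle x.2).1, ?_⟩⟩
    · simp only [Fintype.sum_prod_type (f := fun x : ι × Fin d => q x.1 * (d : ℝ)⁻¹),
        ← Finset.mul_sum, hunif, mul_one, h.2.1]
    · rw [Matrix.trace_kronecker, (h.2.2 x.1).2, (hsingle x.2).2, mul_one]
  refine ⟨_, _, hens, ?_⟩
  rw [holevo_tensor_erasure hΦ p hens]
  have hmix : ∑ x : ι × Fin d, ((q x.1 * (d : ℝ)⁻¹ : ℝ) : ℂ) •
      (ρ x.1 ⊗ₖ Matrix.single x.2 x.2 (1 : ℂ)) =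
      (∑ x, (q x : ℂ) • ρ x) ⊗ₖ Matrix.diagonal fun _ : Fin d => (((d : ℝ)⁻¹ : ℝ) : ℂ) := by
    rw [Fintype.sum_prod_type]
    ext ⟨a, i⟩ ⟨a', j⟩
    simp only [Matrix.sum_apply, Matrix.smul_apply, Matrix.kroneckerMap_apply, smul_eq_mul,
      Finset.sum_mul, Matrix.single_apply, Matrix.diagonal_apply]
    refine Finset.sum_congr rfl fun x _ => ?_
    by_cases hij : i = j
    · simp [hij]
      ring
    · simp only [hij, if_false, mul_zero]
      refine Finset.sum_eq_zero fun k _ => ?_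
      rw [if_neg (fun hk => hij (hk.1.symm.trans hk.2)), mul_zero, mul_zero]
  have hpure : ∀ x : ι × Fin d, entropy (Φ (ρ x.1) ⊗ₖ Matrix.single x.2 x.2 (1 : ℂ)) =
      entropy (Φ (ρ x.1)) := by
    intro x
    have h1 : Matrix.single x.2 x.2 (1 : ℂ) =
        Matrix.diagonal fun k => ((Pi.single x.2 (1 : ℝ) : Fin d → ℝ) k : ℂ) := by
      rw [← Matrix.diagonal_single]
      congr 1
      ext k
      by_cases hk : k = x.2
      · subst hk; simp
      · simp [hk]
    have h2 : ∀ k, negMulLog ((Pi.single x.2 (1 : ℝ) : Fin d → ℝ) k) = 0 := by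
      intro k
      by_cases hk : k = x.2
      · subst hk; simp
      · simp [hk]
    rw [h1, entropy_kronecker_diagonal (hΦ.isState (h.2.2 x.1)) (by simp)]
    simp [h2]
  have hlog : (∑ _k : Fin d, negMulLog (d : ℝ)⁻¹) / Real.log 2 = Real.logb 2 d := by
    rw [Finset.sum_const, Finset.card_univ, Fintype.card_fin, nsmul_eq_mul, Real.negMulLog,
      Real.log_inv, Real.logb]
    field_simp
  have hsum : ∀ f : ι → ℝ, ∑ x : ι × Fin d, q x.1 * (d : ℝ)⁻¹ * f x.1 = ∑ x, q x * f x := by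
    intro f
    rw [Fintype.sum_prod_type]
    refine Finset.sum_congr rfl fun x _ => ?_
    change ∑ _k : Fin d, q x * (d : ℝ)⁻¹ * f x = q x * f x
    rw [← Finset.sum_mul, ← Finset.mul_sum, hunif, mul_one]
  have hmarg : ∑ x : ι × Fin d, ((q x.1 * (d : ℝ)⁻¹ : ℝ) : ℂ) • ρ x.1 =
      ∑ x, (q x : ℂ) • ρ x := by
    have := congrArg traceSnd hmix
    rw [traceSnd_sum_smul, traceSnd_kronecker, Matrix.trace_diagonal, ← Complex.ofReal_sum, hunif,
      Complex.ofReal_one, one_smul] at this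
    simpa only [htr] using this
  simp only [holevo, hmix, tensor_kronecker, LinearMap.id_apply, hpure, htr, hmarg,
    hsum fun x => entropy (Φ (ρ x))]
  rw [entropy_kronecker_diagonal (hΦ.isState h.isState) hunif, hlog]
  ring

/-- One use of the erasure channel adds exactly `(1 - p) log d`. -/
lemma isGreatest_infoValues_tensor_erasure [Nonempty A] {Φ : SuperOp A B} (hΦ : IsChannel Φ)
    {p : ℝ} (hp0 : 0 ≤ p) (hp1 : p ≤ 1) {d : ℕ} (hd : 1 ≤ d) {c : ℝ}
    (hc : IsGreatest (infoValues Φ) c) :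
    IsGreatest (infoValues (tensor Φ (erasure p d))) (c + (1 - p) * Real.logb 2 d) := by
  have hE : IsChannel (tensor Φ (erasure p d)) := hΦ.tensor (isKraus_erasure hp0 hp1 d).isChannel
  have : Nonempty (Fin d) := ⟨⟨0, hd⟩⟩
  constructor
  · obtain ⟨m, q, ρ, h, rfl⟩ := (mem_infoValues hΦ).1 hc.1
    obtain ⟨q', ρ', h', heq⟩ := exists_holevo_tensor_erasure hΦ p hd h
    rw [← heq]
    exact h'.holevo_mem hE
  · intro v hv
    obtain ⟨m, q, ρ, h, rfl⟩ := (mem_infoValues hE).1 hv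
    rw [holevo_tensor_erasure hΦ p h]
    have h1 := holevo_tensor_id_le hΦ hc.2 h
    have h2 := hc.2 (h.traceSnd.holevo_mem hΦ)
    rw [Fintype.card_fin] at h1
    nlinarith [mul_le_mul_of_nonneg_left h1 (sub_nonneg.2 hp1), mul_le_mul_of_nonneg_left h2 hp0]

end Erasure

/-! ### Tensor powers -/

section Powers

variable {A B C D : Type*} [Fintype A] [Fintype B] [Fintype C] [Fintype D]
  [DecidableEq A] [DecidableEq B] [DecidableEq C] [DecidableEq D]

lemma tensorPow_single (Ψ : SuperOp C D) (n : ℕ) (k l : Fin n → C) :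
    tensorPow Ψ n (Matrix.single k l 1) =
      Matrix.of fun i j : Fin n → D => ∏ t, Ψ (Matrix.single (k t) (l t) 1) (i t) (j t) := by
  change ∑ k', ∑ l', Matrix.single k l (1 : ℂ) k' l' • _ = _
  rw [Finset.sum_eq_single k (fun k' _ h => Finset.sum_eq_zero fun l' _ => by
    rw [Matrix.single_apply_of_row_ne h.symm, zero_smul]) (by simp),
    Finset.sum_eq_single l (fun l' _ h => by
      rw [Matrix.single_apply_of_col_ne _ _ h.symm, zero_smul]) (by simp)]
  simp

/-- Relabelled superoperators can be compared on matrix units. -/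
lemma map_submatrix_of_single {A' B' : Type*} [Fintype A'] [Fintype B'] [DecidableEq A']
    [DecidableEq B'] {Φ : SuperOp A B} {Φ' : SuperOp A' B'} (eA : A ≃ A') (eB : B ≃ B')
    (h : ∀ k l, Φ' (Matrix.single (eA k) (eA l) 1) =
      (Φ (Matrix.single k l 1)).submatrix eB.symm eB.symm) (ρ : Matrix A A ℂ) :
    Φ' (ρ.submatrix eA.symm eA.symm) = (Φ ρ).submatrix eB.symm eB.symm := by
  have : Φ' (ρ.submatrix eA.symm eA.symm) =
      ∑ k, ∑ l, ρ k l • Φ' (Matrix.single (eA k) (eA l) 1) := by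
    rw [map_eq_sum_single Φ', ← eA.sum_comp]
    refine Finset.sum_congr rfl fun k _ => ?_
    rw [← eA.sum_comp]
    simp
  rw [this, map_eq_sum_single Φ]
  simp only [h]
  ext b b'
  simp [Matrix.sum_apply]

/-- Absorbing the first of `n + 1` systems. -/
def consAssoc (A C : Type*) (n : ℕ) : (A × C) × (Fin n → C) ≃ A × (Fin (n + 1) → C) :=
  (Equiv.prodAssoc A C _).trans ((Equiv.refl A).prodCongr (Fin.consEquiv fun _ => C))

lemma tensor_tensorPow_succ (Φ : SuperOp A B) (Ψ : SuperOp C D) (n : ℕ)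
    (ρ : Matrix ((A × C) × (Fin n → C)) ((A × C) × (Fin n → C)) ℂ) :
    tensor Φ (tensorPow Ψ (n + 1))
        (ρ.submatrix (consAssoc A C n).symm (consAssoc A C n).symm) =
      (tensor (tensor Φ Ψ) (tensorPow Ψ n) ρ).submatrix (consAssoc B D n).symm
        (consAssoc B D n).symm := by
  refine map_submatrix_of_single _ _ (fun k l => ?_) ρ
  obtain ⟨⟨a, c⟩, k⟩ := k
  obtain ⟨⟨a', c'⟩, l⟩ := l
  rw [tensor_single, tensor_single, tensor_single, tensorPow_single, tensorPow_single]
  ext ⟨b, i⟩ ⟨b', j⟩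
  simp [consAssoc, Fin.prod_univ_succ, mul_assoc, Fin.tail]

lemma tensor_tensorPow_zero (Φ : SuperOp A B) (Ψ : SuperOp C D) (ρ : Matrix A A ℂ) :
    tensor Φ (tensorPow Ψ 0) (ρ.submatrix (Equiv.prodUnique A (Fin 0 → C)).symm.symm
        (Equiv.prodUnique A (Fin 0 → C)).symm.symm) =
      (Φ ρ).submatrix (Equiv.prodUnique B (Fin 0 → D)).symm.symm
        (Equiv.prodUnique B (Fin 0 → D)).symm.symm := by
  refine map_submatrix_of_single _ _ (fun k l => ?_) ρ
  rw [tensor_single, tensorPow_single]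
  ext ⟨b, i⟩ ⟨b', j⟩
  simp

lemma IsChannel.tensor_tensorPow {C D : Type} [Fintype C] [Fintype D] [DecidableEq C]
    [DecidableEq D] {Ψ : SuperOp C D} (hΨ : IsChannel Ψ) (n : ℕ) {A B : Type*}
    [Fintype A] [Fintype B] [DecidableEq A] [DecidableEq B] {Φ : SuperOp A B}
    (hΦ : IsChannel Φ) : IsChannel (QInfo.tensor Φ (tensorPow Ψ n)) := by
  induction n generalizing A B with
  | zero => exact hΦ.reindex _ _ (tensor_tensorPow_zero Φ Ψ)
  | succ n ih => exact (ih (hΦ.tensor hΨ)).reindex _ _ (tensor_tensorPow_succ Φ Ψ n)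

/-- The induction runs over all channels, since one erasure channel is absorbed into `Φ` at each
step. -/
lemma isGreatest_infoValues_tensor_tensorPow_erasure {p : ℝ} (hp0 : 0 ≤ p) (hp1 : p ≤ 1) {d : ℕ}
    (hd : 1 ≤ d) (n : ℕ) {A : Type*} {B : Type*} [Fintype A] [Fintype B] [DecidableEq A]
    [DecidableEq B] [Nonempty A] {Φ : SuperOp A B} (hΦ : IsChannel Φ) {c : ℝ}
    (hc : IsGreatest (infoValues Φ) c) :
    IsGreatest (infoValues (tensor Φ (tensorPow (erasure p d) n)))
      (c + n * ((1 - p) * Real.logb 2 d)) := by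
  have hE : IsChannel (erasure p d) := (isKraus_erasure hp0 hp1 d).isChannel
  have : Nonempty (Fin d) := ⟨⟨0, hd⟩⟩
  induction n generalizing A B c with
  | zero =>
    rw [infoValues_reindex hΦ _ _ (tensor_tensorPow_zero Φ (erasure p d))]
    simpa using hc
  | succ n ih =>
    rw [infoValues_reindex (hE.tensor_tensorPow n (hΦ.tensor hE)) _ _
      (tensor_tensorPow_succ Φ (erasure p d) n)]
    convert ih (hΦ.tensor hE) (isGreatest_infoValues_tensor_erasure hΦ hp0 hp1 hd hc) using 1
    push_cast
    ring

/-- On a one dimensional system nothing can be transmitted. -/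
lemma isGreatest_infoValues_id_unit :
    IsGreatest (infoValues (LinearMap.id : SuperOp Unit Unit)) 0 := by
  have hch : IsChannel (LinearMap.id : SuperOp Unit Unit) := isKraus_id.isChannel
  have hone : ∀ {ρ : Matrix Unit Unit ℂ}, IsState ρ → entropy ρ = 0 := by
    intro ρ hρ
    have : ρ = Matrix.diagonal fun _ => ((1 : ℝ) : ℂ) := by
      ext i j
      have h1 : ρ () () = 1 := by simpa [Matrix.trace] using hρ.2
      simpa using h1
    rw [this, entropy_diagonal]
    simp
  have hzero : ∀ {m : ℕ} {q : Fin m → ℝ} {ρ : Fin m → Matrix Unit Unit ℂ}, IsEnsemble q ρ →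
      holevo (LinearMap.id : SuperOp Unit Unit) q ρ = 0 := by
    intro m q ρ h
    simp only [holevo, LinearMap.id_apply, hone h.isState, hone (h.2.2 _)]
    simp
  obtain ⟨m, q, ρ, h, heq⟩ := (mem_infoValues hch).1 hch.isGreatest_classicalInfo.1
  rw [hzero h] at heq
  rw [← heq]
  exact hch.isGreatest_classicalInfo

lemma isGreatest_infoValues_erasure {p : ℝ} (hp0 : 0 ≤ p) (hp1 : p ≤ 1) {d : ℕ} (hd : 1 ≤ d) :
    IsGreatest (infoValues (erasure p d)) ((1 - p) * Real.logb 2 d) := by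
  have hch : IsChannel (LinearMap.id : SuperOp Unit Unit) := isKraus_id.isChannel
  have h := isGreatest_infoValues_tensor_erasure hch hp0 hp1 hd isGreatest_infoValues_id_unit
  rw [zero_add] at h
  rwa [infoValues_reindex (hch.tensor (isKraus_erasure hp0 hp1 d).isChannel)
    (Equiv.punitProd (Fin d)) (Equiv.punitProd (Option (Fin d)))
    (map_submatrix_of_single _ _ fun k l => ?_)]
  rw [tensor_single]
  ext i j
  simp

end Powers
end QInfo

end

theorem lemma3 {A B : Type*} [Fintype A] [Fintype B] [DecidableEq A] [DecidableEq B] [Nonempty A]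
    (N : QInfo.SuperOp A B) (hN : QInfo.IsChannel N)
    (p : ℝ) (hp0 : 0 ≤ p) (hp1 : p ≤ 1) (d : ℕ) (hd : 1 ≤ d) (n : ℕ) :
    -- all the maxima defining the three classical informations are attained
    IsGreatest (QInfo.infoValues N) (QInfo.classicalInfo N) ∧
    IsGreatest (QInfo.infoValues (QInfo.erasure p d))
      (QInfo.classicalInfo (QInfo.erasure p d)) ∧
    IsGreatest (QInfo.infoValues (QInfo.tensor N (QInfo.tensorPow (QInfo.erasure p d) n)))
      (QInfo.classicalInfo (QInfo.tensor N (QInfo.tensorPow (QInfo.erasure p d) n))) ∧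
    -- additivity
    QInfo.classicalInfo (QInfo.tensor N (QInfo.tensorPow (QInfo.erasure p d) n)) =
      QInfo.classicalInfo N + n * QInfo.classicalInfo (QInfo.erasure p d) ∧
    QInfo.classicalInfo (QInfo.erasure p d) = (1 - p) * Real.logb 2 d := by
  have h1 := hN.isGreatest_classicalInfo
  have h2 := QInfo.isGreatest_infoValues_erasure hp0 hp1 hd
  have h3 := QInfo.isGreatest_infoValues_tensor_tensorPow_erasure hp0 hp1 hd n hN h1
  have e2 : QInfo.classicalInfo (QInfo.erasure p d) = (1 - p) * Real.logb 2 d := h2.csSup_eq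
  have e3 : QInfo.classicalInfo (QInfo.tensor N (QInfo.tensorPow (QInfo.erasure p d) n)) =
      QInfo.classicalInfo N + n * ((1 - p) * Real.logb 2 d) := h3.csSup_eq
  rw [e3, e2]
  exact ⟨h1, h2, h3, rfl, rfl⟩
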